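/- Let $S^2\subset\mathbb{R}^3$ be the unit sphere, with the metric $d\theta^2$ induced from $\mathbb{R}^3$ and its area measure, and let $\mathcal{M}=S^2\times(0,\infty)$, with points $z=(\bar x,\sigma)$. For $z\in\mathcal{M}$ let $p(\cdot\,|\,z)$ be the von Mises–Fisher density with mean direction $\bar x$ and concentration parameter $\sigma$, that is, the probability density on $S^2$, with respect to area, proportional to $x\mapsto\exp(\sigma\langle x,\bar x\rangle)$. Write $\ell(z)=\log p(x|z)$. Then $\ell$ is differentiable in $z$, for $u,v\in T_z\mathcal{M}$ the product $d\ell(z)(u)\,d\ell(z)(v)$ is integrable with respect to $p(\cdot\,|\,z)$, and the Rao–Fisher metric $ds^2(z)(u,v)=\mathbb{E}_z\big[d\ell(z)(u)\,d\ell(z)(v)\big]$ is a smooth Riemannian metric on $\mathcal{M}$, given by $$ds^2(z)=I_0(\sigma)\,d\sigma^2+I_1(\sigma)\,d\theta^2(\bar x),\qquad I_0(\sigma)=\sigma^{-2}-\sinh^{-2}\sigma,\qquad I_1(\sigma)=\sigma\coth\sigma-1,$$ where $\sinh^{-2}\sigma=1/(\sinh\sigma)^2$. Let $K^{\mathcal{M}}$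 be the sectional curvature of $(\mathcal{M},ds^2)$. On every plane tangent to a sphere $S^2\times\{\sigma\}$, it is equal to $$\frac{1}{I_1(\sigma)}-\frac14\left(\frac{\partial_r I_1(\sigma)}{I_1(\sigma)}\right)^2,\qquad \partial_r=I_0(\sigma)^{-1/2}\,\partial_\sigma ,$$ and $K^{\mathcal{M}}(u,v)<0$ for every $z\in\mathcal{M}$ and all linearly independent $u,v\in T_z\mathcal{M}$. -/

import Mathlib

open MeasureTheory Module
open scoped Manifold ContDiff Bundle

noncomputable section

/-! ### Curvature of a Riemannian metric, in charts -/

namespace RiemCurv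

section Coordinates

variable {E : Type*} [NormedAddCommGroup E] [NormedSpace ℝ E]
  {ι : Type*} [Fintype ι] [DecidableEq ι]

/-- Christoffel symbols `Γ^k_{ij}` at `y`, with respect to the linear coordinates of the basis `b`,
of the metric with coefficient matrix `G = (g_{ij})`:
`Γ^k_{ij} = ½ ∑_l g^{kl} (∂_i g_{jl} + ∂_j g_{il} - ∂_l g_{ij})`. -/
def christoffel (b : Basis ι ℝ E) (G : E → Matrix ι ι ℝ) (k i j : ι) (y : E) : ℝ :=
  (1 / 2) * ∑ l, (G y)⁻¹ k l *
    (fderiv ℝ (fun x => G x j l) y (b i) + fderiv ℝ (fun x => G x i l) y (b j)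
      - fderiv ℝ (fun x => G x i j) y (b l))

/-- Components of the curvature tensor of the Levi-Civita connection,
`R(∂_i, ∂_j) ∂_k = ∑_l R^l_{ijk} ∂_l` where
`R(X, Y) Z = ∇_X ∇_Y Z - ∇_Y ∇_X Z - ∇_{[X, Y]} Z`. -/
def curvatureCoeff (b : Basis ι ℝ E) (G : E → Matrix ι ι ℝ) (l i j k : ι) (y : E) : ℝ :=
  fderiv ℝ (christoffel b G l j k) y (b i) - fderiv ℝ (christoffel b G l i k) y (b j)
    + ∑ m, (christoffel b G l i m y * christoffel b G m j k y
      - christoffel b G l j m y * christoffel b G m i k y)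

/-- `⟨R(u, v) v, u⟩` at `y`, for vectors with coordinates `u` and `v`. -/
def curvatureForm (b : Basis ι ℝ E) (G : E → Matrix ι ι ℝ) (y : E) (u v : ι → ℝ) : ℝ :=
  ∑ l, ∑ m, ∑ i, ∑ j, ∑ k, G y l m * curvatureCoeff b G l i j k y * u i * v j * v k * u m

end Coordinates

section Manifold

variable {E : Type*} [NormedAddCommGroup E] [NormedSpace ℝ E]
  {H : Type*} [TopologicalSpace H] {I : ModelWithCorners ℝ E H} [I.Boundaryless]
  {M : Type*} [TopologicalSpace M] [ChartedSpace H M] [IsManifold I ∞ M]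
  {ι : Type*} [Fintype ι] [DecidableEq ι]

/-- Coefficient matrix `g_{ij}` of the metric `g`, as a function on the image of the chart
around `p`. -/
def metricInChart (b : Basis ι ℝ E)
    (g : Bundle.ContMDiffRiemannianMetric I ∞ E (fun z : M => TangentSpace I z)) (p : M) (y : E) :
    Matrix ι ι ℝ :=
  Matrix.of fun i j =>
    g.inner ((extChartAt I p).symm y)
      (mfderiv 𝓘(ℝ, E) I (extChartAt I p).symm y (b i))
      (mfderiv 𝓘(ℝ, E) I (extChartAt I p).symm y (b j))

/-- Coordinates of a tangent vector at `p` in the chart around `p`. -/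
def tangentCoord (I : ModelWithCorners ℝ E H) [I.Boundaryless]
    (b : Basis ι ℝ E) (p : M) (u : TangentSpace I p) : ι → ℝ :=
  b.repr (mfderiv I 𝓘(ℝ, E) (extChartAt I p) p u)

/-- Sectional curvature `⟨R(u, v) v, u⟩ / (|u|² |v|² - ⟨u, v⟩²)` of the metric `g` on the plane
spanned by the linearly independent tangent vectors `u` and `v` at `p`, computed in the chart
around `p` (its value depends neither on the chart nor on the basis `b` of the model space). -/
def sectionalCurvature (b : Basis ι ℝ E)
    (g : Bundle.ContMDiffRiemannianMetric I ∞ E (fun z : M => TangentSpace I z)) (p : M)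
    (u v : TangentSpace I p) : ℝ :=
  curvatureForm b (metricInChart b g p) (extChartAt I p p) (tangentCoord I b p u)
      (tangentCoord I b p v)
    / (g.inner p u u * g.inner p v v - g.inner p u v ^ 2)

end Manifold

end RiemCurv

/-! ### Rao–Fisher metric of a statistical model -/

/-- Score: the derivative in the direction `u`, at the parameter `z`, of the log-likelihood
`w ↦ log p(x | w)`. -/
def score {E : Type*} [NormedAddCommGroup E] [NormedSpace ℝ E]
    {H : Type*} [TopologicalSpace H] (I : ModelWithCorners ℝ E H)
    {P : Type*} [TopologicalSpace P] [ChartedSpace H P]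
    {X : Type*} (p : P → X → ℝ) (z : P) (u : TangentSpace I z) (x : X) : ℝ :=
  mvfderiv I (fun w => Real.log (p w x)) z u

/-- Rao–Fisher information form `E_z[dℓ(u) dℓ(v)]` of the family of densities `p(· | z)` with
respect to `μ`, where `ℓ(z) = log p(x | z)`. -/
def fisherForm {E : Type*} [NormedAddCommGroup E] [NormedSpace ℝ E]
    {H : Type*} [TopologicalSpace H] (I : ModelWithCorners ℝ E H)
    {P : Type*} [TopologicalSpace P] [ChartedSpace H P]
    {X : Type*} [MeasurableSpace X] (μ : Measure X)
    (p : P → X → ℝ) (z : P) (u v : TangentSpace I z) : ℝ :=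
  ∫ x, score I p z u x * score I p z v x * p z x ∂μ

/-! ### The von Mises–Fisher model on the unit sphere of `ℝ³` -/

namespace VMF

/-- The unit sphere `S²` in `ℝ³`. -/
abbrev S2 : Type := Metric.sphere (0 : EuclideanSpace ℝ (Fin 3)) 1

/-- The half-line `(0, ∞)`, as an open submanifold of `ℝ`. -/
abbrev Pos : TopologicalSpace.Opens ℝ := ⟨Set.Ioi 0, isOpen_Ioi⟩

/-- The parameter manifold `S² × (0, ∞)`. -/
abbrev Param : Type := S2 × Pos

/-- The model with corners of the (boundaryless) manifold `S² × (0, ∞)`. -/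
abbrev J : ModelWithCorners ℝ (EuclideanSpace ℝ (Fin 2) × ℝ)
    (ModelProd (EuclideanSpace ℝ (Fin 2)) ℝ) :=
  (𝓡 2).prod 𝓘(ℝ, ℝ)

/-- The standard basis of the model space `ℝ² × ℝ`. -/
def stdBasis : Basis (Fin 2 ⊕ Unit) ℝ (EuclideanSpace ℝ (Fin 2) × ℝ) :=
  (EuclideanSpace.basisFun (Fin 2) ℝ).toBasis.prod (Basis.singleton Unit ℝ)

/-- Surface area on `S²` (total mass `4π`). -/
def area : Measure S2 := (volume : Measure (EuclideanSpace ℝ (Fin 3))).toSphere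

/-- von Mises–Fisher density of mean direction `z.1` and concentration parameter `z.2`, with respect
to surface area: it is proportional to `x ↦ exp (σ ⟨x, x̄⟩)`. -/
def density (z : Param) (x : S2) : ℝ :=
  Real.exp ((z.2 : ℝ) * inner ℝ (x : EuclideanSpace ℝ (Fin 3)) z.1) /
    ∫ y : S2, Real.exp ((z.2 : ℝ) * inner ℝ (y : EuclideanSpace ℝ (Fin 3)) z.1) ∂area

/-- The one-form `dσ` on `S² × (0, ∞)`. -/
def dσ (z : Param) (u : TangentSpace J z) : ℝ :=
  mvfderiv J (fun w : Param => (w.2 : ℝ)) z u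

/-- The quadratic form `dθ²`, polarised: the metric of `S²` induced from `ℝ³`, pulled back to
`S² × (0, ∞)` by the projection. -/
def dθsq (z : Param) (u v : TangentSpace J z) : ℝ :=
  inner ℝ (mvfderiv J (fun w : Param => (w.1 : EuclideanSpace ℝ (Fin 3))) z u)
    (mvfderiv J (fun w : Param => (w.1 : EuclideanSpace ℝ (Fin 3))) z v)

/-- `I₀(σ) = σ⁻² - sinh⁻² σ`. -/
def I₀ (σ : ℝ) : ℝ := 1 / σ ^ 2 - 1 / Real.sinh σ ^ 2

/-- `I₁(σ) = σ coth σ - 1`. -/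
def I₁ (σ : ℝ) : ℝ := σ * (Real.cosh σ / Real.sinh σ) - 1

/-- Derivative `∂_r f = I₀^{-1/2} ∂_σ f` with respect to the vertical distance coordinate `r`,
`dr / dσ = I₀^{1/2}`. -/
def derivR (f : ℝ → ℝ) (σ : ℝ) : ℝ := deriv f σ / Real.sqrt (I₀ σ)

end VMF

end

noncomputable section

/-! ### Power series of exponential polynomials -/

/-! The log-likelihood is σ⟨x, x̄⟩ - ψ(σ), where ψ(σ) = log(C sinh σ / σ) and C is the area of the
sphere, so the score is (⟨x, x̄⟩ - ψ'(σ)) dσ + σ⟨x, dx̄⟩ with ψ' = I₁/σ. Reflections preserve area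
and kill the cross terms. What remains is the variance of t = ⟨x, x̄⟩ and a tangential second
moment; both follow from the invariance of the Laplace transform of area under rotations, which ties
the tangential moments to the first moment of t and yields a linear differential equation for the
normalising constant (`mul_sphereMoment_zero`, `fisherForm_eq`).

The metric is therefore a warped product f(r)² dθ² + dr² with f = √I₁ and dr = √I₀ dσ. In
stereographic coordinates centred at the point considered, the curvature operator is diagonal on
coordinate planes, with eigenvalue (1 - f_r²)/f² on planes tangent to a sphere and -f_rr/f on planes
containing ∂_σ. Every sectional curvature is a weighted mean of these two numbers, the weights being
the squared minors of the pair of vectors (`sectionalCurvature_fisherMetric`), so it suffices that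
both are negative.

After clearing denominators, these two signs are inequalities between polynomials in σ, sinh σ and
cosh σ (`spherical_inequality`, `radial_inequality`). Each is, up to a positive factor, the even or
odd part of an exponential polynomial, and all its Taylor coefficients of that parity are
nonnegative: small indices are computed, large ones are governed by the fastest exponential. -/

/-- Multiplying the exponential series by x^j shifts the index by j. The truncated exponent `n - j`
is harmless, since the falling factorial vanishes for n < j. -/
theorem hasSum_pow_mul_exp (j : ℕ) (k x : ℝ) :
    HasSum (fun n : ℕ => (n.descFactorial j : ℝ) * k ^ (n - j) * (x ^ n / n.factorial))
      (x ^ j * Real.exp (k * x)) := by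
  have h := (NormedSpace.expSeries_div_hasSum_exp (k * x)).mul_left (x ^ j)
  rw [← Real.exp_eq_exp_ℝ] at h
  have h0 : ∑ i ∈ Finset.range j,
      ((i.descFactorial j : ℝ) * k ^ (i - j) * (x ^ i / i.factorial)) = 0 := by
    refine Finset.sum_eq_zero fun i hi => ?_
    rw [Nat.descFactorial_of_lt (Finset.mem_range.1 hi)]
    simp
  have h1 := (hasSum_nat_add_iff (f := fun n : ℕ =>
    (n.descFactorial j : ℝ) * k ^ (n - j) * (x ^ n / n.factorial)) (g := x ^ j * Real.exp (k * x)) j)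
  rw [h0, add_zero] at h1
  refine h1.1 ?_
  refine Eq.mp (congrArg (fun f => HasSum f _) (funext fun n => Eq.symm ?_)) h
  have h2 : ((n + j).factorial : ℝ) = n.factorial * (n + j).descFactorial j := by
    have := Nat.factorial_mul_descFactorial (n := n + j) (k := j) (by omega)
    rw [Nat.add_sub_cancel] at this
    exact_mod_cast this.symm
  have h3 : ((n + j).descFactorial j : ℝ) ≠ 0 := by
    have : 0 < (n + j).descFactorial j := Nat.descFactorial_pos.2 (by omega)
    positivity
  have h4 : (n.factorial : ℝ) ≠ 0 := by positivity
  rw [h2, Nat.add_sub_cancel]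
  field_simp
  ring

/-- The odd part of a function with nonnegative odd Taylor coefficients is positive. -/
theorem sub_neg_pos_of_hasSum {g : ℕ → ℝ} {G : ℝ → ℝ} {N : ℕ} {x : ℝ} (hx : 0 < x)
    (hG : ∀ y, HasSum (fun n : ℕ => g n * (y ^ n / n.factorial)) (G y))
    (hg : ∀ n, Odd n → 0 ≤ g n) (hN : Odd N) (hgN : 0 < g N) : 0 < G x - G (-x) := by
  have h := (hG x).sub (hG (-x))
  have h0 : ∀ n : ℕ, 0 ≤ g n * (x ^ n / n.factorial) - g n * ((-x) ^ n / n.factorial) := by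
    intro n
    rcases Nat.even_or_odd n with hn | hn
    · simp [hn.neg_pow]
    · have := hg n hn
      rw [hn.neg_pow, neg_div, mul_neg, sub_neg_eq_add]
      positivity
  rw [← h.tsum_eq]
  refine h.summable.tsum_pos h0 N ?_
  rw [hN.neg_pow, neg_div, mul_neg, sub_neg_eq_add]
  positivity

/-- The even part of a function with nonnegative even Taylor coefficients is positive. -/
theorem add_neg_pos_of_hasSum {g : ℕ → ℝ} {G : ℝ → ℝ} {N : ℕ} {x : ℝ} (hx : 0 < x)
    (hG : ∀ y, HasSum (fun n : ℕ => g n * (y ^ n / n.factorial)) (G y))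
    (hg : ∀ n, Even n → 0 ≤ g n) (hN : Even N) (hgN : 0 < g N) : 0 < G x + G (-x) := by
  have h := (hG x).add (hG (-x))
  have h0 : ∀ n : ℕ, 0 ≤ g n * (x ^ n / n.factorial) + g n * ((-x) ^ n / n.factorial) := by
    intro n
    rcases Nat.even_or_odd n with hn | hn
    · have := hg n hn
      rw [hn.neg_pow]
      positivity
    · simp [hn.neg_pow, neg_div]
  rw [← h.tsum_eq]
  refine h.summable.tsum_pos h0 N ?_
  rw [hN.neg_pow]
  positivity

/-! ### Inequalities between hyperbolic functions -/

/-- Taylor coefficients of the exponential polynomial behind `radial_inequality`. -/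
def radialCoeff (n : ℕ) : ℝ :=
  -10 * 2 ^ n + 8 * 4 ^ n - 2 * 6 ^ n
    + n * (74 * 0 ^ (n - 1) - 97 * 2 ^ (n - 1) + 22 * 4 ^ (n - 1) + 6 ^ (n - 1))
    + n.descFactorial 2 * (64 * 2 ^ (n - 2) - 32 * 4 ^ (n - 2))
    + n.descFactorial 3 * (52 * 0 ^ (n - 3) - 80 * 2 ^ (n - 3) + 28 * 4 ^ (n - 3))
    + n.descFactorial 4 * (48 * 2 ^ (n - 4) - 8 * 4 ^ (n - 4))
    + n.descFactorial 5 * (-32 * 2 ^ (n - 5))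

theorem hasSum_radialCoeff (x : ℝ) :
    HasSum (fun n : ℕ => radialCoeff n * (x ^ n / n.factorial))
      (-10 * Real.exp (2 * x) + 8 * Real.exp (4 * x) - 2 * Real.exp (6 * x)
        + x * (74 - 97 * Real.exp (2 * x) + 22 * Real.exp (4 * x) + Real.exp (6 * x))
        + x ^ 2 * (64 * Real.exp (2 * x) - 32 * Real.exp (4 * x))
        + x ^ 3 * (52 - 80 * Real.exp (2 * x) + 28 * Real.exp (4 * x))
        + x ^ 4 * (48 * Real.exp (2 * x) - 8 * Real.exp (4 * x))
        + x ^ 5 * (-32 * Real.exp (2 * x))) := by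
  have e (c : ℝ) (j : ℕ) (k : ℝ) := (hasSum_pow_mul_exp j k x).mul_left c
  convert ((e (-10) 0 2).add <| (e 8 0 4).add <| (e (-2) 0 6).add <| (e 74 1 0).add <|
    (e (-97) 1 2).add <| (e 22 1 4).add <| (e 1 1 6).add <| (e 64 2 2).add <| (e (-32) 2 4).add <|
    (e 52 3 0).add <| (e (-80) 3 2).add <| (e 28 3 4).add <| (e 48 4 2).add <| (e (-8) 4 4).add <|
    (e (-32) 5 2)) using 1
  · rfl
  · funext n
    simp only [radialCoeff, Nat.descFactorial_zero, Nat.descFactorial_one, Nat.sub_zero]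
    push_cast
    ring
  · simp only [zero_mul, Real.exp_zero]
    ring

/-- The constant is fixed by the budget in `radialCoeff_nonneg_of_ge`: once 2^n is factored out, the
leading term 3^n (n - 12)/6 is at least (3/2) 3^n for n ≥ 21. The term 2^n n⁴/32 uses up 40/32 = 5/4
of it, and `pow_five_le` bounds 2n⁵ by the remaining 1/4. -/
theorem two_pow_mul_pow_four_le {n : ℕ} (hn : 21 ≤ n) : (2 : ℝ) ^ n * n ^ 4 ≤ 40 * 3 ^ n := by
  induction n, hn using Nat.le_induction with
  | base => norm_num
  | succ n hn ih =>
    have h : (21 : ℝ) ≤ n := by exact_mod_cast hn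
    have h1 : 2 * ((n : ℝ) + 1) ^ 4 ≤ 3 * n ^ 4 := by
      nlinarith [pow_le_pow_left₀ (by norm_num) h 2, pow_le_pow_left₀ (by norm_num) h 3,
        mul_nonneg (sub_nonneg.2 h) (by positivity : (0 : ℝ) ≤ n ^ 3),
        mul_nonneg (sub_nonneg.2 h) (by positivity : (0 : ℝ) ≤ n ^ 2),
        mul_nonneg (sub_nonneg.2 h) (by positivity : (0 : ℝ) ≤ n)]
    have h2 : (0 : ℝ) < 2 ^ n := by positivity
    push_cast
    rw [pow_succ (2 : ℝ), pow_succ (3 : ℝ)]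
    nlinarith

theorem pow_five_le {n : ℕ} (hn : 21 ≤ n) : 2 * (n : ℝ) ^ 5 ≤ 3 ^ n / 4 := by
  induction n, hn using Nat.le_induction with
  | base => norm_num
  | succ n hn ih =>
    have h : (21 : ℝ) ≤ n := by exact_mod_cast hn
    have h1 : ((n : ℝ) + 1) ^ 5 ≤ 3 * n ^ 5 := by
      nlinarith [pow_le_pow_left₀ (by norm_num) h 2, pow_le_pow_left₀ (by norm_num) h 3,
        mul_nonneg (sub_nonneg.2 h) (by positivity : (0 : ℝ) ≤ n ^ 4),
        mul_nonneg (sub_nonneg.2 h) (by positivity : (0 : ℝ) ≤ n ^ 3),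
        mul_nonneg (sub_nonneg.2 h) (by positivity : (0 : ℝ) ≤ n ^ 2),
        mul_nonneg (sub_nonneg.2 h) (by positivity : (0 : ℝ) ≤ n)]
    push_cast
    rw [pow_succ (3 : ℝ)]
    linarith

theorem cast_descFactorial_two (n : ℕ) : (n.descFactorial 2 : ℝ) = n * (n - 1) := by
  rw [← descPochhammer_eval_eq_descFactorial]; simp [descPochhammer]

theorem cast_descFactorial_three (n : ℕ) :
    (n.descFactorial 3 : ℝ) = n * (n - 1) * (n - 2) := by
  rw [← descPochhammer_eval_eq_descFactorial]; simp [descPochhammer]; ring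

theorem cast_descFactorial_four (n : ℕ) :
    (n.descFactorial 4 : ℝ) = n * (n - 1) * (n - 2) * (n - 3) := by
  rw [← descPochhammer_eval_eq_descFactorial]; simp [descPochhammer]; ring

theorem cast_descFactorial_five (n : ℕ) :
    (n.descFactorial 5 : ℝ) = n * (n - 1) * (n - 2) * (n - 3) * (n - 4) := by
  rw [← descPochhammer_eval_eq_descFactorial]; simp [descPochhammer]; ring

theorem radialCoeff_nonneg_of_ge {n : ℕ} (hn : 21 ≤ n) : 0 ≤ radialCoeff n := by
  have a1 := two_pow_mul_pow_four_le hn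
  have a2 := pow_five_le hn
  have h : (21 : ℝ) ≤ n := by exact_mod_cast hn
  have hp : (1 : ℝ) ≤ 2 ^ n := one_le_pow₀ (by norm_num)
  have hq : (0 : ℝ) < 3 ^ n := by positivity
  have key : radialCoeff n = 2 ^ n * (3 ^ n * ((n : ℝ) - 12) / 6
      + 2 ^ n * (8 + 11 / 2 * n - 2 * n * (n - 1) + 7 / 16 * (n * (n - 1) * (n - 2))
        - n * (n - 1) * (n - 2) * (n - 3) / 32)
      + (-10 - 97 / 2 * n + 16 * n * (n - 1) - 10 * (n * (n - 1) * (n - 2))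
        + 3 * (n * (n - 1) * (n - 2) * (n - 3))
        - n * (n - 1) * (n - 2) * (n - 3) * (n - 4))) := by
    -- For n ≥ 21 the powers of 0, which encode the purely polynomial terms, vanish.
    unfold radialCoeff
    rw [cast_descFactorial_two, cast_descFactorial_three, cast_descFactorial_four,
      cast_descFactorial_five, zero_pow (by omega), zero_pow (by omega)]
    iterate 10 rw [pow_sub₀ _ (by norm_num) (by omega)]
    rw [show (6 : ℝ) = 2 * 3 by norm_num, show (4 : ℝ) = 2 * 2 by norm_num, mul_pow, mul_pow]
    ring
  rw [key]
  refine mul_nonneg (by positivity) ?_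
  have hn0 : (0 : ℝ) ≤ n := by positivity
  have b1 : -(n : ℝ) ^ 4 / 32 ≤ 8 + 11 / 2 * n - 2 * n * (n - 1) + 7 / 16 * (n * (n - 1) * (n - 2))
        - n * (n - 1) * (n - 2) * (n - 3) / 32 := by
    nlinarith [mul_nonneg (sub_nonneg.2 h) (by positivity : (0 : ℝ) ≤ n ^ 2),
      mul_nonneg (sub_nonneg.2 h) hn0]
  have b2 : -2 * (n : ℝ) ^ 5 ≤ -10 - 97 / 2 * n + 16 * n * (n - 1) - 10 * (n * (n - 1) * (n - 2))
        + 3 * (n * (n - 1) * (n - 2) * (n - 3))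
        - n * (n - 1) * (n - 2) * (n - 3) * (n - 4) := by
    nlinarith [mul_nonneg (sub_nonneg.2 h) (by positivity : (0 : ℝ) ≤ n ^ 4),
      mul_nonneg (sub_nonneg.2 h) (by positivity : (0 : ℝ) ≤ n ^ 3),
      mul_nonneg (sub_nonneg.2 h) (by positivity : (0 : ℝ) ≤ n ^ 2),
      mul_nonneg (sub_nonneg.2 h) hn0]
  have b3 := mul_le_mul_of_nonneg_left b1 (by positivity : (0 : ℝ) ≤ 2 ^ n)
  have b4 := mul_le_mul_of_nonneg_left h hq.le
  linarith

theorem radialCoeff_nonneg {n : ℕ} (hn : Odd n) : 0 ≤ radialCoeff n := by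
  rcases le_or_gt 21 n with h | h
  · exact radialCoeff_nonneg_of_ge h
  · interval_cases n <;> first
      | exact absurd hn (by decide)
      | norm_num [radialCoeff, Nat.descFactorial]

/-- The function in `radial_inequality` vanishes to order 15 at 0, the terms in x¹¹ and x¹³
cancelling, so this is the first nonzero odd coefficient. -/
theorem radialCoeff_fifteen_pos : 0 < radialCoeff 15 := by
  norm_num [radialCoeff, Nat.descFactorial]

/-- Taylor coefficients of the exponential polynomial behind `spherical_inequality`. -/
def sphericalCoeff (n : ℕ) : ℝ :=
  12 * 0 ^ n - 16 * 2 ^ n + 4 * 4 ^ n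
    + n * (8 * 2 ^ (n - 1) - 4 * 4 ^ (n - 1))
    + n.descFactorial 2 * (15 * 0 ^ (n - 2) - 16 * 2 ^ (n - 2) + 4 ^ (n - 2))
    + n.descFactorial 3 * (8 * 2 ^ (n - 3))
    + n.descFactorial 4 * (8 * 0 ^ (n - 4))

theorem hasSum_sphericalCoeff (x : ℝ) :
    HasSum (fun n : ℕ => sphericalCoeff n * (x ^ n / n.factorial))
      (12 - 16 * Real.exp (2 * x) + 4 * Real.exp (4 * x)
        + x * (8 * Real.exp (2 * x) - 4 * Real.exp (4 * x))
        + x ^ 2 * (15 - 16 * Real.exp (2 * x) + Real.exp (4 * x))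
        + x ^ 3 * (8 * Real.exp (2 * x)) + x ^ 4 * 8) := by
  have e (c : ℝ) (j : ℕ) (k : ℝ) := (hasSum_pow_mul_exp j k x).mul_left c
  convert ((e 12 0 0).add <| (e (-16) 0 2).add <| (e 4 0 4).add <| (e 8 1 2).add <|
    (e (-4) 1 4).add <| (e 15 2 0).add <| (e (-16) 2 2).add <| (e 1 2 4).add <|
    (e 8 3 2).add <| (e 8 4 0)) using 1
  · rfl
  · funext n
    simp only [sphericalCoeff, Nat.descFactorial_zero, Nat.descFactorial_one, Nat.sub_zero]
    push_cast
    ring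
  · simp only [zero_mul, Real.exp_zero]
    ring

theorem sphericalCoeff_nonneg {n : ℕ} (hn : Even n) : 0 ≤ sphericalCoeff n := by
  rcases le_or_gt 16 n with h | h
  · have hr : (16 : ℝ) ≤ n := by exact_mod_cast h
    have key : sphericalCoeff n = 2 ^ n * (2 ^ n * (4 - n + n * (n - 1) / 16)
        + (-16 + 4 * n - 4 * n * (n - 1) + n * (n - 1) * (n - 2))) := by
      unfold sphericalCoeff
      rw [cast_descFactorial_two, cast_descFactorial_three, cast_descFactorial_four,
        zero_pow (by omega), zero_pow (by omega), zero_pow (by omega)]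
      iterate 5 rw [pow_sub₀ _ (by norm_num) (by omega)]
      rw [show (4 : ℝ) = 2 * 2 by norm_num, mul_pow]
      ring
    rw [key]
    -- The coefficient of 4^n; for n ≥ 16 it is at least 4 - n + (n - 1) = 3.
    have c1 : 0 ≤ 4 - (n : ℝ) + n * (n - 1) / 16 := by nlinarith
    have c2 : 0 ≤ -16 + 4 * (n : ℝ) - 4 * n * (n - 1) + n * (n - 1) * (n - 2) := by
      nlinarith [mul_nonneg (sub_nonneg.2 hr) (by positivity : (0 : ℝ) ≤ n ^ 2),
        mul_nonneg (sub_nonneg.2 hr) (by positivity : (0 : ℝ) ≤ n)]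
    positivity
  · interval_cases n <;> first
      | exact absurd hn (by decide)
      | norm_num [sphericalCoeff, Nat.descFactorial]

/-- Index 12 is the order of vanishing at 0 of the function in `spherical_inequality`, whose terms
in x⁸ and x¹⁰ cancel. -/
theorem sphericalCoeff_twelve_pos : 0 < sphericalCoeff 12 := by
  norm_num [sphericalCoeff, Nat.descFactorial]

section Hyperbolic

open Real

theorem exp_nat_mul_two (x : ℝ) :
    exp (2 * x) = exp x ^ 2 ∧ exp (4 * x) = exp x ^ 4 ∧ exp (6 * x) = exp x ^ 6 := by
  refine ⟨?_, ?_, ?_⟩ <;> rw [← exp_nat_mul] <;> norm_num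

/-- The right-hand side is odd in x. Expanded in exponentials, 64 times it is G(x) - G(-x), where G
is the sum in `hasSum_radialCoeff`; only the odd coefficients of G matter. -/
theorem radial_inequality {x : ℝ} (hx : 0 < x) :
    0 < 4 * (x * cosh x - sinh x) ^ 2 * x * (sinh x ^ 2 - x ^ 2)
      + 2 * (sinh x ^ 3 - x ^ 3 * cosh x) * (x * cosh x - sinh x) * (sinh x * cosh x - x)
      - (sinh x * cosh x - x) ^ 2 * x * (sinh x ^ 2 - x ^ 2) := by
  have h := sub_neg_pos_of_hasSum hx hasSum_radialCoeff (fun n => radialCoeff_nonneg)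
    (by decide : Odd 15) radialCoeff_fifteen_pos
  obtain ⟨e2, e4, e6⟩ := exp_nat_mul_two x
  obtain ⟨f2, f4, f6⟩ := exp_nat_mul_two (-x)
  have hm : exp x * exp (-x) = 1 := by rw [← exp_add]; simp
  rw [e2, e4, e6, f2, f4, f6] at h
  rw [sinh_eq, cosh_eq]
  generalize exp x = a at *
  generalize exp (-x) = b at *
  refine lt_of_mul_lt_mul_left (a := 64) ?_ (by norm_num)
  rw [mul_zero]
  refine lt_of_lt_of_eq h ?_
  have ha : a ≠ 0 := left_ne_zero_of_mul_eq_one hm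
  obtain rfl : b = a⁻¹ := eq_inv_of_mul_eq_one_right hm
  field_simp
  ring

/-- The difference of the two sides is even in x, and 16 times it is G(x) + G(-x) for the sum G in
`hasSum_sphericalCoeff`. -/
theorem spherical_inequality {x : ℝ} (hx : 0 < x) :
    4 * (x * cosh x - sinh x) * sinh x * (sinh x ^ 2 - x ^ 2)
      < x ^ 2 * (sinh x * cosh x - x) ^ 2 := by
  have h := add_neg_pos_of_hasSum hx hasSum_sphericalCoeff (fun n => sphericalCoeff_nonneg)
    (by decide : Even 12) sphericalCoeff_twelve_pos
  obtain ⟨e2, e4, -⟩ := exp_nat_mul_two x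
  obtain ⟨f2, f4, -⟩ := exp_nat_mul_two (-x)
  have hm : exp x * exp (-x) = 1 := by rw [← exp_add]; simp
  rw [e2, e4, f2, f4] at h
  rw [sinh_eq, cosh_eq]
  generalize exp x = a at *
  generalize exp (-x) = b at *
  refine lt_of_mul_lt_mul_left (a := 16) ?_ (by norm_num)
  rw [← sub_pos]
  refine lt_of_lt_of_eq h ?_
  have ha : a ≠ 0 := left_ne_zero_of_mul_eq_one hm
  obtain rfl : b = a⁻¹ := eq_inv_of_mul_eq_one_right hm
  field_simp
  ring

end Hyperbolic

/-! ### Signs of the metric coefficients and of the two curvature functions -/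

namespace VMF

open Real

/-- The derivative of `I₁`. -/
def derivI₁ (σ : ℝ) : ℝ := cosh σ / sinh σ - σ / sinh σ ^ 2

/-- The derivative of `I₀`. -/
def derivI₀ (σ : ℝ) : ℝ := 2 * cosh σ / sinh σ ^ 3 - 2 / σ ^ 3

theorem hasDerivAt_I₁ {σ : ℝ} (hσ : 0 < σ) : HasDerivAt I₁ (derivI₁ σ) σ := by
  have hs : sinh σ ≠ 0 := (sinh_pos_iff.2 hσ).ne'
  have h := ((hasDerivAt_id σ).mul ((hasDerivAt_cosh σ).div (hasDerivAt_sinh σ) hs)).sub_const 1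
  convert! h using 1
  have e : sinh σ * sinh σ - cosh σ * cosh σ = -1 := by linear_combination -cosh_sq σ
  simp only [derivI₁, id, Pi.div_apply, e]
  field_simp
  ring

theorem hasDerivAt_derivI₁ {σ : ℝ} (hσ : 0 < σ) :
    HasDerivAt derivI₁ (2 * I₁ σ / sinh σ ^ 2) σ := by
  have hs : sinh σ ≠ 0 := (sinh_pos_iff.2 hσ).ne'
  have h := ((hasDerivAt_cosh σ).div (hasDerivAt_sinh σ) hs).sub
    ((hasDerivAt_id σ).div ((hasDerivAt_sinh σ).pow 2) (pow_ne_zero 2 hs))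
  convert! h using 1
  have e : sinh σ * sinh σ - cosh σ * cosh σ = -1 := by linear_combination -cosh_sq σ
  simp only [I₁, id, Pi.pow_apply, e]
  push_cast
  field_simp
  ring

theorem hasDerivAt_I₀ {σ : ℝ} (hσ : 0 < σ) : HasDerivAt I₀ (derivI₀ σ) σ := by
  have hs : sinh σ ≠ 0 := (sinh_pos_iff.2 hσ).ne'
  have hσ' : σ ≠ 0 := hσ.ne'
  have h := ((hasDerivAt_const σ (1 : ℝ)).div ((hasDerivAt_id σ).pow 2) (pow_ne_zero 2 hσ')).sub
    ((hasDerivAt_const σ (1 : ℝ)).div ((hasDerivAt_sinh σ).pow 2) (pow_ne_zero 2 hs))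
  convert! h using 1
  simp only [derivI₀, id, Pi.pow_apply]
  field_simp
  ring

theorem differentiableAt_derivI₀ {σ : ℝ} (hσ : 0 < σ) : DifferentiableAt ℝ derivI₀ σ := by
  have hs : sinh σ ≠ 0 := (sinh_pos_iff.2 hσ).ne'
  unfold derivI₀
  fun_prop (disch := first | positivity | exact pow_ne_zero 3 hs)

theorem contDiffAt_I₀ {σ : ℝ} (hσ : 0 < σ) : ContDiffAt ℝ ∞ I₀ σ := by
  have hs : sinh σ ≠ 0 := (sinh_pos_iff.2 hσ).ne'
  unfold I₀
  fun_prop (disch := first | positivity | exact pow_ne_zero 2 hs)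

theorem contDiffAt_I₁ {σ : ℝ} (hσ : 0 < σ) : ContDiffAt ℝ ∞ I₁ σ := by
  have hs : sinh σ ≠ 0 := (sinh_pos_iff.2 hσ).ne'
  unfold I₁
  fun_prop (disch := exact hs)

theorem I₀_eq {σ : ℝ} (hσ : 0 < σ) :
    I₀ σ = (sinh σ ^ 2 - σ ^ 2) / (σ ^ 2 * sinh σ ^ 2) := by
  have hs : sinh σ ≠ 0 := (sinh_pos_iff.2 hσ).ne'
  unfold I₀
  field_simp

theorem I₁_eq {σ : ℝ} (hσ : 0 < σ) : I₁ σ = (σ * cosh σ - sinh σ) / sinh σ := by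
  have hs : sinh σ ≠ 0 := (sinh_pos_iff.2 hσ).ne'
  unfold I₁
  field_simp

theorem derivI₁_eq {σ : ℝ} (hσ : 0 < σ) :
    derivI₁ σ = (sinh σ * cosh σ - σ) / sinh σ ^ 2 := by
  have hs : sinh σ ≠ 0 := (sinh_pos_iff.2 hσ).ne'
  unfold derivI₁
  field_simp

theorem I₀_pos {σ : ℝ} (hσ : 0 < σ) : 0 < I₀ σ := by
  have hs := sinh_pos_iff.2 hσ
  have h : σ < sinh σ := self_lt_sinh_iff.2 hσ
  rw [I₀_eq hσ]
  have : 0 < sinh σ ^ 2 - σ ^ 2 := by nlinarith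
  positivity

/-- The difference vanishes at 0 and has derivative σ sinh σ. -/
theorem sinh_lt_mul_cosh {σ : ℝ} (hσ : 0 < σ) : sinh σ < σ * cosh σ := by
  have hmono : StrictMonoOn (fun x => x * cosh x - sinh x) (Set.Ici 0) := by
    refine strictMonoOn_of_deriv_pos (convex_Ici 0) (by fun_prop) fun x hx => ?_
    rw [interior_Ici] at hx
    have h : HasDerivAt (fun x => x * cosh x - sinh x) (x * sinh x) x := by
      convert! ((hasDerivAt_id x).mul (hasDerivAt_cosh x)).sub (hasDerivAt_sinh x) using 1
      simp
    rw [h.deriv]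
    exact mul_pos hx (sinh_pos_iff.2 hx)
  have h := hmono Set.self_mem_Ici hσ.le hσ
  simp only [cosh_zero, sinh_zero, mul_one, sub_zero] at h
  linarith

theorem I₁_pos {σ : ℝ} (hσ : 0 < σ) : 0 < I₁ σ := by
  have hs := sinh_pos_iff.2 hσ
  rw [I₁_eq hσ]
  exact div_pos (sub_pos.2 (sinh_lt_mul_cosh hσ)) hs

/-- Curvature of the planes tangent to the spheres `S² × {σ}`. -/
def sphericalCurvature (σ : ℝ) : ℝ := 1 / I₁ σ - derivI₁ σ ^ 2 / (4 * I₁ σ ^ 2 * I₀ σ)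

/-- Curvature of the planes that contain the direction `∂_σ`. -/
def radialCurvature (σ : ℝ) : ℝ :=
  -(2 * I₁ σ / sinh σ ^ 2 - derivI₁ σ ^ 2 / (2 * I₁ σ) - derivI₁ σ * derivI₀ σ / (2 * I₀ σ))
    / (2 * I₁ σ * I₀ σ)

theorem sphericalCurvature_neg {σ : ℝ} (hσ : 0 < σ) : sphericalCurvature σ < 0 := by
  have hs := sinh_pos_iff.2 hσ
  have h0 := I₀_pos hσ
  have h1 := I₁_pos hσ
  have key : 4 * I₁ σ * I₀ σ < derivI₁ σ ^ 2 := by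
    rw [I₀_eq hσ, I₁_eq hσ, derivI₁_eq hσ, ← sub_pos]
    have := spherical_inequality hσ
    have e : ((sinh σ * cosh σ - σ) / sinh σ ^ 2) ^ 2 - 4 * ((σ * cosh σ - sinh σ) / sinh σ)
        * ((sinh σ ^ 2 - σ ^ 2) / (σ ^ 2 * sinh σ ^ 2))
        = (σ ^ 2 * (sinh σ * cosh σ - σ) ^ 2
          - 4 * (σ * cosh σ - sinh σ) * sinh σ * (sinh σ ^ 2 - σ ^ 2)) / (σ ^ 2 * sinh σ ^ 4) := by
      field_simp
    rw [e]
    exact div_pos (sub_pos.2 this) (by positivity)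
  have e : sphericalCurvature σ
      = -(derivI₁ σ ^ 2 - 4 * I₁ σ * I₀ σ) / (4 * I₁ σ ^ 2 * I₀ σ) := by
    unfold sphericalCurvature
    field_simp
    ring
  rw [e, neg_div]
  exact neg_neg_of_pos (div_pos (sub_pos.2 key) (by positivity))

theorem radialCurvature_neg {σ : ℝ} (hσ : 0 < σ) : radialCurvature σ < 0 := by
  have hs := sinh_pos_iff.2 hσ
  have h0 := I₀_pos hσ
  have h1 := I₁_pos hσ
  have key : 0 < 4 * I₁ σ ^ 2 * I₀ σ / sinh σ ^ 2 - derivI₁ σ ^ 2 * I₀ σ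
      - derivI₁ σ * derivI₀ σ * I₁ σ := by
    have := radial_inequality hσ
    have e : 4 * I₁ σ ^ 2 * I₀ σ / sinh σ ^ 2 - derivI₁ σ ^ 2 * I₀ σ
        - derivI₁ σ * derivI₀ σ * I₁ σ
        = (4 * (σ * cosh σ - sinh σ) ^ 2 * σ * (sinh σ ^ 2 - σ ^ 2)
      + 2 * (sinh σ ^ 3 - σ ^ 3 * cosh σ) * (σ * cosh σ - sinh σ) * (sinh σ * cosh σ - σ)
      - (sinh σ * cosh σ - σ) ^ 2 * σ * (sinh σ ^ 2 - σ ^ 2)) / (σ ^ 3 * sinh σ ^ 6) := by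
      rw [I₀_eq hσ, I₁_eq hσ, derivI₁_eq hσ, derivI₀]
      field_simp
      ring
    rw [e]
    positivity
  have e : radialCurvature σ = -(4 * I₁ σ ^ 2 * I₀ σ / sinh σ ^ 2 - derivI₁ σ ^ 2 * I₀ σ
      - derivI₁ σ * derivI₀ σ * I₁ σ) / (4 * I₁ σ ^ 2 * I₀ σ ^ 2) := by
    unfold radialCurvature
    field_simp
    ring
  rw [e, neg_div]
  exact neg_neg_of_pos (div_pos key (by positivity))

theorem sphericalCurvature_eq {σ : ℝ} (hσ : 0 < σ) :
    sphericalCurvature σ = 1 / I₁ σ - (1 / 4) * (derivR I₁ σ / I₁ σ) ^ 2 := by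
  have h0 := I₀_pos hσ
  have h1 := I₁_pos hσ
  rw [sphericalCurvature, derivR, (hasDerivAt_I₁ hσ).deriv, div_pow, div_pow, sq_sqrt h0.le]
  field_simp

end VMF

/-! ### Curvature of warped products over the sphere, in stereographic coordinates -/

namespace RiemCurv

open Filter Topology

section Congr

variable {E : Type*} [NormedAddCommGroup E] [NormedSpace ℝ E]
  {ι : Type*} [Fintype ι] [DecidableEq ι]

/-- Equality is needed near y and not only at y, because the curvature differentiates the
Christoffel symbols once more. -/
theorem christoffel_congr (b : Basis ι ℝ E) {G G' : E → Matrix ι ι ℝ} {y : E}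
    (h : G =ᶠ[𝓝 y] G') (k i j : ι) :
    christoffel b G k i j =ᶠ[𝓝 y] christoffel b G' k i j := by
  filter_upwards [h.eventuallyEq_nhds] with x hx
  have hd (i j : ι) : fderiv ℝ (fun x => G x i j) x = fderiv ℝ (fun x => G' x i j) x :=
    Filter.EventuallyEq.fderiv_eq (hx.mono fun y hy => by simp only [hy])
  simp only [christoffel, hx.self_of_nhds, hd]

/-- Curvature components, from the values and the derivatives of the Christoffel symbols. -/
theorem curvatureCoeff_eq (b : Basis ι ℝ E) {G : E → Matrix ι ι ℝ} {y : E}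
    {Γ : ι → ι → ι → E → ℝ} {D : ι → ι → ι → ι → ℝ}
    (hΓ : ∀ k i j, christoffel b G k i j =ᶠ[𝓝 y] Γ k i j)
    (hD : ∀ k i j m, fderiv ℝ (Γ k i j) y (b m) = D k i j m) (l i j k : ι) :
    curvatureCoeff b G l i j k y = D l j k i - D l i k j
      + ∑ m, (Γ l i m y * Γ m j k y - Γ l j m y * Γ m i k y) := by
  simp only [curvatureCoeff, (hΓ _ _ _).fderiv_eq, hD, (hΓ _ _ _).self_of_nhds]

end Congr

/-- The metric `a(t) ds² + h(t) dt²` on `ℝ² × ℝ`, where `ds²` is the metric of the unit sphere in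
stereographic coordinates. -/
def warpedMatrix (a h : ℝ → ℝ) (y : EuclideanSpace ℝ (Fin 2) × ℝ) :
    Matrix (Fin 2 ⊕ Unit) (Fin 2 ⊕ Unit) ℝ :=
  Matrix.diagonal (Sum.elim (fun _ => a y.2 * (16 / (4 + ‖y.1‖ ^ 2) ^ 2)) (fun _ => h y.2))

/-- Christoffel symbols of `warpedMatrix`, where `a₁` and `h₁` are the derivatives of `a`, `h`. -/
def warpedChristoffel (a a₁ h h₁ : ℝ → ℝ) :
    Fin 2 ⊕ Unit → Fin 2 ⊕ Unit → Fin 2 ⊕ Unit → EuclideanSpace ℝ (Fin 2) × ℝ → ℝ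
  | .inl k, .inl i, .inl j, y => (-2 / (4 + ‖y.1‖ ^ 2)) *
      ((if k = i then y.1 j else 0) + (if k = j then y.1 i else 0) - (if i = j then y.1 k else 0))
  | .inl k, .inl i, .inr _, y => if k = i then a₁ y.2 / (2 * a y.2) else 0
  | .inl k, .inr _, .inl j, y => if k = j then a₁ y.2 / (2 * a y.2) else 0
  | .inl _, .inr _, .inr _, _ => 0
  | .inr _, .inl i, .inl j, y =>
      if i = j then -(a₁ y.2 / (2 * h y.2)) * (16 / (4 + ‖y.1‖ ^ 2) ^ 2) else 0
  | .inr _, .inl _, .inr _, _ => 0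
  | .inr _, .inr _, .inl _, _ => 0
  | .inr _, .inr _, .inr _, y => h₁ y.2 / (2 * h y.2)

theorem hasFDerivAt_stereographicFactor (w : EuclideanSpace ℝ (Fin 2)) :
    HasFDerivAt (fun w : EuclideanSpace ℝ (Fin 2) => 16 / (4 + ‖w‖ ^ 2) ^ 2)
      ((-64 / (4 + ‖w‖ ^ 2) ^ 3) • innerSL ℝ w) w := by
  have h0 : (4 + ‖w‖ ^ 2) ≠ 0 := by positivity
  have h1 : HasDerivAt (fun s : ℝ => 16 / (4 + s) ^ 2) (-32 / (4 + ‖w‖ ^ 2) ^ 3) (‖w‖ ^ 2) := by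
    have := (hasDerivAt_const (‖w‖ ^ 2) (16 : ℝ)).div
      (((hasDerivAt_id (‖w‖ ^ 2)).const_add 4).pow 2) (pow_ne_zero 2 h0)
    convert! this using 1
    simp only [id, Pi.pow_apply]
    field_simp
    ring
  have h2 := h1.comp_hasFDerivAt w (hasStrictFDerivAt_norm_sq w).hasFDerivAt
  convert! h2 using 1
  ext v
  simp
  ring

theorem stdBasis_inl (i : Fin 2) : VMF.stdBasis (.inl i) = (EuclideanSpace.single i 1, 0) := by
  ext <;> simp [VMF.stdBasis]

theorem stdBasis_inr (i : Unit) : VMF.stdBasis (.inr i) = (0, 1) := by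
  ext <;> simp [VMF.stdBasis]

section Warped

variable {a h a₁ h₁ : ℝ → ℝ} {y : EuclideanSpace ℝ (Fin 2) × ℝ}

theorem hasFDerivAt_warpedMatrix_inl (ha : HasDerivAt a (a₁ y.2) y.2) :
    HasFDerivAt (fun x => a x.2 * (16 / (4 + ‖x.1‖ ^ 2) ^ 2))
     (a y.2 • (((-64 / (4 + ‖y.1‖ ^ 2) ^ 3) • innerSL ℝ y.1) ∘L
        ContinuousLinearMap.fst ℝ (EuclideanSpace ℝ (Fin 2)) ℝ)
      + (16 / (4 + ‖y.1‖ ^ 2) ^ 2) • (a₁ y.2 •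
        ContinuousLinearMap.snd ℝ (EuclideanSpace ℝ (Fin 2)) ℝ)) y := by
  have h1 := (hasFDerivAt_stereographicFactor y.1).comp y (hasFDerivAt_fst (𝕜 := ℝ) (p := y))
  have h2 := ha.comp_hasFDerivAt y (hasFDerivAt_snd (𝕜 := ℝ) (p := y))
  exact h2.mul h1

/-- Derivatives of the coefficients of `warpedMatrix`. -/
def warpedDeriv (a a₁ h₁ : ℝ → ℝ) (y : EuclideanSpace ℝ (Fin 2) × ℝ) :
    Fin 2 ⊕ Unit → Fin 2 ⊕ Unit → ℝ
  | .inl _, .inl k => -64 / (4 + ‖y.1‖ ^ 2) ^ 3 * a y.2 * y.1 k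
  | .inl _, .inr _ => 16 / (4 + ‖y.1‖ ^ 2) ^ 2 * a₁ y.2
  | .inr _, .inl _ => 0
  | .inr _, .inr _ => h₁ y.2

theorem fderiv_warpedMatrix (ha : HasDerivAt a (a₁ y.2) y.2) (hh : HasDerivAt h (h₁ y.2) y.2)
    (i j k : Fin 2 ⊕ Unit) :
    fderiv ℝ (fun x => warpedMatrix a h x i j) y (VMF.stdBasis k) =
      if i = j then warpedDeriv a a₁ h₁ y i k else 0 := by
  rcases eq_or_ne i j with rfl | hij
  · rcases i with i | i
    · have := (hasFDerivAt_warpedMatrix_inl ha).fderiv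
      simp only [warpedMatrix, Matrix.diagonal_apply_eq, Sum.elim_inl, this, if_true]
      rcases k with k | k
      · simp [stdBasis_inl, warpedDeriv, EuclideanSpace.inner_single_right]
        ring
      · simp [stdBasis_inr, warpedDeriv]
    · have h2 := (hh.comp_hasFDerivAt y (hasFDerivAt_snd (𝕜 := ℝ) (p := y))).fderiv
      simp only [Function.comp_def] at h2
      simp only [warpedMatrix, Matrix.diagonal_apply_eq, Sum.elim_inr, h2, if_true]
      rcases k with k | k
      · simp [stdBasis_inl, warpedDeriv]
      · simp [stdBasis_inr, warpedDeriv]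
  · simp [warpedMatrix, hij]

/-- The metric is diagonal, so its inverse is too and the sum over l reduces to the term l = k. -/
theorem christoffel_warpedMatrix (ha : HasDerivAt a (a₁ y.2) y.2)
    (hh : HasDerivAt h (h₁ y.2) y.2) (ha0 : a y.2 ≠ 0) (hh0 : h y.2 ≠ 0) (k i j : Fin 2 ⊕ Unit) :
    christoffel VMF.stdBasis (warpedMatrix a h) k i j y = warpedChristoffel a a₁ h h₁ k i j y := by
  have h0 : 4 + ‖y.1‖ ^ 2 ≠ 0 := by positivity
  have hinv : (warpedMatrix a h y)⁻¹ = Matrix.diagonal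
      (Sum.elim (fun _ => (a y.2 * (16 / (4 + ‖y.1‖ ^ 2) ^ 2))⁻¹) (fun _ => (h y.2)⁻¹)) := by
    refine Matrix.inv_eq_right_inv ?_
    rw [warpedMatrix, Matrix.diagonal_mul_diagonal, ← Matrix.diagonal_one]
    congr 1
    funext i
    rcases i with i | i
    · simp only [Sum.elim_inl]
      exact mul_inv_cancel₀ (by positivity)
    · exact mul_inv_cancel₀ hh0
  simp only [christoffel, fderiv_warpedMatrix ha hh, hinv, Matrix.diagonal_apply, ite_mul, zero_mul,
    Finset.sum_ite_eq, Finset.mem_univ, if_true]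
  rcases k with k | k <;> rcases i with i | i <;> rcases j with j | j <;>
    simp only [Sum.elim_inl, Sum.elim_inr, warpedDeriv, warpedChristoffel, reduceCtorEq, if_false,
      Sum.inl.injEq, if_true, add_zero, sub_zero, zero_add, sub_self, mul_zero]
  · fin_cases k <;> fin_cases i <;> fin_cases j <;> simp <;> field_simp <;> ring
  · simp only [eq_comm (a := i)]
    split_ifs <;> field_simp <;> ring
  · simp only [eq_comm (a := j)]
    split_ifs <;> field_simp <;> ring
  · split_ifs <;> field_simp <;> ring
  · field_simp
    ring

end Warped

end RiemCurv

namespace RiemCurv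

open Filter Topology

section WarpedCurvature

variable {a h a₁ h₁ : ℝ → ℝ} {a₂ h₂ σ : ℝ}

/-- Derivatives of the Christoffel symbols `warpedChristoffel`, at `(0, σ)`. -/
def warpedChristoffelDeriv (a a₁ h h₁ : ℝ → ℝ) (a₂ h₂ σ : ℝ) :
    Fin 2 ⊕ Unit → Fin 2 ⊕ Unit → Fin 2 ⊕ Unit → Fin 2 ⊕ Unit → ℝ
  | .inl k, .inl i, .inl j, .inl m => (-1 / 2) *
      ((if k = i then if j = m then 1 else 0 else 0) + (if k = j then if i = m then 1 else 0 else 0)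
        - (if i = j then if k = m then 1 else 0 else 0))
  | .inl k, .inl i, .inr _, .inr _ =>
      if k = i then (a₂ * a σ - a₁ σ ^ 2) / (2 * a σ ^ 2) else 0
  | .inl k, .inr _, .inl j, .inr _ =>
      if k = j then (a₂ * a σ - a₁ σ ^ 2) / (2 * a σ ^ 2) else 0
  | .inr _, .inl i, .inl j, .inr _ =>
      if i = j then -((a₂ * h σ - a₁ σ * h₁ σ) / (2 * h σ ^ 2)) else 0
  | .inr _, .inr _, .inr _, .inr _ => (h₂ * h σ - h₁ σ ^ 2) / (2 * h σ ^ 2)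
  | _, _, _, _ => 0

/-- The factor -2/(4 + ‖w‖²) has a critical point at the origin with value -1/2, so only the
derivative of the linear factor survives there. -/
theorem hasFDerivAt_coord_div (k : Fin 2) (σ : ℝ) :
    HasFDerivAt (fun y : EuclideanSpace ℝ (Fin 2) × ℝ => (-2 / (4 + ‖y.1‖ ^ 2)) * y.1 k)
      ((-1 / 2 : ℝ) • (EuclideanSpace.proj k ∘L
        ContinuousLinearMap.fst ℝ (EuclideanSpace ℝ (Fin 2)) ℝ)) (0, σ) := by
  have h1 : HasFDerivAt (fun w : EuclideanSpace ℝ (Fin 2) => (-2 / (4 + ‖w‖ ^ 2)))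
      (0 : EuclideanSpace ℝ (Fin 2) →L[ℝ] ℝ) 0 := by
    have h1 : HasDerivAt (fun s : ℝ => -2 / (4 + s)) (2 / 16) (‖(0 : EuclideanSpace ℝ (Fin 2))‖ ^ 2) := by
      have := (hasDerivAt_const (‖(0 : EuclideanSpace ℝ (Fin 2))‖ ^ 2) (-2 : ℝ)).div
        ((hasDerivAt_id (‖(0 : EuclideanSpace ℝ (Fin 2))‖ ^ 2)).const_add 4) (by simp)
      convert! this using 1
      norm_num
    have h2 := h1.comp_hasFDerivAt (0 : EuclideanSpace ℝ (Fin 2))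
      (hasStrictFDerivAt_norm_sq (0 : EuclideanSpace ℝ (Fin 2))).hasFDerivAt
    convert! h2 using 1
    simp
  have h2 := (h1.mul (EuclideanSpace.proj k : EuclideanSpace ℝ (Fin 2) →L[ℝ] ℝ).hasFDerivAt).comp
    ((0, σ) : EuclideanSpace ℝ (Fin 2) × ℝ) (hasFDerivAt_fst (𝕜 := ℝ) (p := ((0, σ) : EuclideanSpace ℝ (Fin 2) × ℝ)))
  convert! h2 using 1
  ext v <;> simp
  norm_num

theorem fderiv_coord_div_combination (c₁ c₂ c₃ : ℝ) (i j k : Fin 2) (σ : ℝ)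
    (v : EuclideanSpace ℝ (Fin 2) × ℝ) :
    fderiv ℝ (fun y : EuclideanSpace ℝ (Fin 2) × ℝ =>
      c₁ * ((-2 / (4 + ‖y.1‖ ^ 2)) * y.1 i) + c₂ * ((-2 / (4 + ‖y.1‖ ^ 2)) * y.1 j)
        - c₃ * ((-2 / (4 + ‖y.1‖ ^ 2)) * y.1 k)) (0, σ) v
      = (-1 / 2) * (c₁ * v.1 i + c₂ * v.1 j - c₃ * v.1 k) := by
  have h := (((hasFDerivAt_coord_div i σ).const_mul c₁).add
    ((hasFDerivAt_coord_div j σ).const_mul c₂)).sub ((hasFDerivAt_coord_div k σ).const_mul c₃)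
  refine (congrArg (fun f => f v) h.fderiv).trans ?_
  change c₁ * ((-1 / 2) * v.1 i) + c₂ * ((-1 / 2) * v.1 j) - c₃ * ((-1 / 2) * v.1 k) = _
  ring

/-- The origin of the sphere coordinates is enough, because each point is the centre of its own
stereographic chart. -/
theorem fderiv_warpedChristoffel (ha : HasDerivAt a (a₁ σ) σ) (ha₁ : HasDerivAt a₁ a₂ σ)
    (hh : HasDerivAt h (h₁ σ) σ) (hh₁ : HasDerivAt h₁ h₂ σ) (ha0 : a σ ≠ 0) (hh0 : h σ ≠ 0)
    (k i j m : Fin 2 ⊕ Unit) :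
    fderiv ℝ (warpedChristoffel a a₁ h h₁ k i j) (0, σ) (VMF.stdBasis m) =
      warpedChristoffelDeriv a a₁ h h₁ a₂ h₂ σ k i j m := by
  have snd_deriv {f : ℝ → ℝ} {f' : ℝ} (hf : HasDerivAt f f' σ) :
      HasFDerivAt (fun y : EuclideanSpace ℝ (Fin 2) × ℝ => f y.2)
        (f' • ContinuousLinearMap.snd ℝ (EuclideanSpace ℝ (Fin 2)) ℝ) (0, σ) :=
    hf.comp_hasFDerivAt ((0, σ) : EuclideanSpace ℝ (Fin 2) × ℝ) hasFDerivAt_snd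
  have hA : HasDerivAt (fun t => a₁ t / (2 * a t)) ((a₂ * a σ - a₁ σ ^ 2) / (2 * a σ ^ 2)) σ := by
    convert! ha₁.div (ha.const_mul 2) (by positivity) using 1
    field_simp
  have hB : HasDerivAt (fun t => -(a₁ t / (2 * h t)))
      (-((a₂ * h σ - a₁ σ * h₁ σ) / (2 * h σ ^ 2))) σ := by
    convert! (ha₁.div (hh.const_mul 2) (by positivity)).neg using 1
    field_simp
  have hC : HasDerivAt (fun t => h₁ t / (2 * h t)) ((h₂ * h σ - h₁ σ ^ 2) / (2 * h σ ^ 2)) σ := by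
    convert! hh₁.div (hh.const_mul 2) (by positivity) using 1
    field_simp
  have hzero : fderiv ℝ (fun _ : EuclideanSpace ℝ (Fin 2) × ℝ => (0 : ℝ)) (0, σ) = 0 := by simp
  rcases k with k | k <;> rcases i with i | i <;> rcases j with j | j
  · have e : warpedChristoffel a a₁ h h₁ (.inl k) (.inl i) (.inl j) = fun y =>
        (if k = i then (1 : ℝ) else 0) * ((-2 / (4 + ‖y.1‖ ^ 2)) * y.1 j)
        + (if k = j then (1 : ℝ) else 0) * ((-2 / (4 + ‖y.1‖ ^ 2)) * y.1 i)
        - (if i = j then (1 : ℝ) else 0) * ((-2 / (4 + ‖y.1‖ ^ 2)) * y.1 k) := by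
      funext y
      simp only [warpedChristoffel]
      split_ifs <;> ring
    rw [e, fderiv_coord_div_combination]
    rcases m with m | m
    · simp [stdBasis_inl, warpedChristoffelDeriv]
      split_ifs <;> norm_num
    · simp [stdBasis_inr, warpedChristoffelDeriv]
  · have e : warpedChristoffel a a₁ h h₁ (.inl k) (.inl i) (.inr j) = fun y =>
        (if k = i then (1 : ℝ) else 0) * (a₁ y.2 / (2 * a y.2)) := by
      funext y
      simp [warpedChristoffel]
    rw [e, ((snd_deriv hA).const_mul _).fderiv]
    rcases m with m | m
    · simp only [stdBasis_inl, warpedChristoffelDeriv]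
      split_ifs <;> simp
    · simp only [stdBasis_inr, warpedChristoffelDeriv]
      split_ifs <;> simp
  · have e : warpedChristoffel a a₁ h h₁ (.inl k) (.inr i) (.inl j) = fun y =>
        (if k = j then (1 : ℝ) else 0) * (a₁ y.2 / (2 * a y.2)) := by
      funext y
      simp [warpedChristoffel]
    rw [e, ((snd_deriv hA).const_mul _).fderiv]
    rcases m with m | m
    · simp only [stdBasis_inl, warpedChristoffelDeriv]
      split_ifs <;> simp
    · simp only [stdBasis_inr, warpedChristoffelDeriv]
      split_ifs <;> simp
  · rw [show warpedChristoffel a a₁ h h₁ (.inl k) (.inr i) (.inr j) = fun _ => 0 from rfl, hzero]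
    rcases m with m | m <;> rfl
  · have e : warpedChristoffel a a₁ h h₁ (.inr k) (.inl i) (.inl j) = fun y =>
        (if i = j then (1 : ℝ) else 0) * (-(a₁ y.2 / (2 * h y.2)) *
          (16 / (4 + ‖y.1‖ ^ 2) ^ 2)) := by
      funext y
      simp only [warpedChristoffel, ite_mul, one_mul, zero_mul]
    have h1 := (hasFDerivAt_stereographicFactor 0).comp ((0, σ) : EuclideanSpace ℝ (Fin 2) × ℝ)
      (hasFDerivAt_fst (𝕜 := ℝ) (p := ((0, σ) : EuclideanSpace ℝ (Fin 2) × ℝ)))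
    have := (((snd_deriv hB).mul h1).const_mul (if i = j then (1 : ℝ) else 0)).fderiv
    rw [e]
    refine (congrArg (fun f => f (VMF.stdBasis m)) this).trans ?_
    simp only [map_zero, smul_zero, ContinuousLinearMap.zero_comp, zero_add]
    rcases m with m | m
    · simp only [stdBasis_inl, warpedChristoffelDeriv]
      split_ifs <;> simp
    · simp only [stdBasis_inr, warpedChristoffelDeriv]
      split_ifs <;> simp
      norm_num
  · rw [show warpedChristoffel a a₁ h h₁ (.inr k) (.inl i) (.inr j) = fun _ => 0 from rfl, hzero]
    rcases m with m | m <;> rfl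
  · rw [show warpedChristoffel a a₁ h h₁ (.inr k) (.inr i) (.inl j) = fun _ => 0 from rfl, hzero]
    rcases m with m | m <;> rfl
  · have e : warpedChristoffel a a₁ h h₁ (.inr k) (.inr i) (.inr j) = fun y =>
        h₁ y.2 / (2 * h y.2) := rfl
    rw [e, (snd_deriv hC).fderiv]
    rcases m with m | m
    · simp [stdBasis_inl, warpedChristoffelDeriv]
    · simp [stdBasis_inr, warpedChristoffelDeriv]

/-- Sectional curvature of the planes spanned by two coordinate vectors, for the metric
`warpedMatrix`. -/
def warpedSectional (a a₁ h h₁ : ℝ → ℝ) (a₂ σ : ℝ) : Fin 2 ⊕ Unit → Fin 2 ⊕ Unit → ℝ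
  | .inl _, .inl _ => 1 / a σ - a₁ σ ^ 2 / (4 * a σ ^ 2 * h σ)
  | _, _ => -(a₂ - a₁ σ ^ 2 / (2 * a σ) - a₁ σ * h₁ σ / (2 * h σ)) / (2 * a σ * h σ)

/-- On coordinate planes the curvature has the constant-curvature form R^l_{ijk} = K_ij (δ_li g_jk -
δ_lj g_ik), with K_ij depending only on whether both directions are tangent to the sphere. -/
theorem curvatureCoeff_of_eventuallyEq_warpedMatrix
    {G : EuclideanSpace ℝ (Fin 2) × ℝ → Matrix (Fin 2 ⊕ Unit) (Fin 2 ⊕ Unit) ℝ}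
    (hG : G =ᶠ[𝓝 (0, σ)] warpedMatrix a h)
    (ha : ∀ᶠ t in 𝓝 σ, HasDerivAt a (a₁ t) t) (ha₁ : HasDerivAt a₁ a₂ σ)
    (hh : ∀ᶠ t in 𝓝 σ, HasDerivAt h (h₁ t) t) (hh₁ : DifferentiableAt ℝ h₁ σ)
    (ha0 : a σ ≠ 0) (hh0 : h σ ≠ 0) (l i j k : Fin 2 ⊕ Unit) :
    curvatureCoeff VMF.stdBasis G l i j k (0, σ) =
      warpedSectional a a₁ h h₁ a₂ σ i j *
        ((if l = i then if j = k then Sum.elim (fun _ => a σ) (fun _ => h σ) j else 0 else 0)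
          - (if l = j then if i = k then Sum.elim (fun _ => a σ) (fun _ => h σ) i else 0 else 0)) := by
  have hΓ (k i j) : christoffel VMF.stdBasis G k i j =ᶠ[𝓝 (0, σ)]
      warpedChristoffel a a₁ h h₁ k i j := by
    refine (christoffel_congr _ hG k i j).trans ?_
    have hc : Tendsto (Prod.snd : EuclideanSpace ℝ (Fin 2) × ℝ → ℝ) (𝓝 (0, σ)) (𝓝 σ) :=
      continuous_snd.tendsto _
    filter_upwards [hc.eventually ha, hc.eventually hh,
      hc.eventually (ha.self_of_nhds.continuousAt.eventually_ne ha0),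
      hc.eventually (hh.self_of_nhds.continuousAt.eventually_ne hh0)] with y h1 h2 h3 h4
    exact christoffel_warpedMatrix h1 h2 h3 h4 k i j
  rw [curvatureCoeff_eq VMF.stdBasis hΓ (fderiv_warpedChristoffel ha.self_of_nhds ha₁
    hh.self_of_nhds hh₁.hasDerivAt ha0 hh0)]
  rcases l with l | l <;> rcases i with i | i <;> rcases j with j | j <;> rcases k with k | k <;>
    simp only [warpedChristoffel, warpedChristoffelDeriv, warpedSectional, Fintype.sum_sum_type,
      Fin.sum_univ_two, Finset.univ_unique, Finset.sum_singleton, reduceCtorEq, if_false,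
      Sum.inl.injEq, if_true, Sum.elim_inl, Sum.elim_inr, PiLp.zero_apply,
      norm_zero, ite_self, sub_zero, add_zero, zero_mul, mul_zero, zero_add, sub_self, zero_sub]
  all_goals
    fin_cases l <;> fin_cases i <;> fin_cases j <;> fin_cases k <;> simp <;> field_simp <;> ring

/-- No product of two different minors occurs, so the form is a sum of squared minors weighted by
the curvatures of the coordinate planes. -/
theorem curvatureForm_of_eventuallyEq_warpedMatrix
    {G : EuclideanSpace ℝ (Fin 2) × ℝ → Matrix (Fin 2 ⊕ Unit) (Fin 2 ⊕ Unit) ℝ}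
    (hG : G =ᶠ[𝓝 (0, σ)] warpedMatrix a h)
    (ha : ∀ᶠ t in 𝓝 σ, HasDerivAt a (a₁ t) t) (ha₁ : HasDerivAt a₁ a₂ σ)
    (hh : ∀ᶠ t in 𝓝 σ, HasDerivAt h (h₁ t) t) (hh₁ : DifferentiableAt ℝ h₁ σ)
    (ha0 : a σ ≠ 0) (hh0 : h σ ≠ 0) (u v : Fin 2 ⊕ Unit → ℝ) :
    curvatureForm VMF.stdBasis G (0, σ) u v =
      (1 / a σ - a₁ σ ^ 2 / (4 * a σ ^ 2 * h σ)) *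
          (a σ ^ 2 * (u (.inl 0) * v (.inl 1) - u (.inl 1) * v (.inl 0)) ^ 2)
        + -(a₂ - a₁ σ ^ 2 / (2 * a σ) - a₁ σ * h₁ σ / (2 * h σ)) / (2 * a σ * h σ) *
          (a σ * h σ * ((u (.inl 0) * v (.inr ()) - u (.inr ()) * v (.inl 0)) ^ 2
            + (u (.inl 1) * v (.inr ()) - u (.inr ()) * v (.inl 1)) ^ 2)) := by
  have hG0 : G (0, σ) = Matrix.diagonal (Sum.elim (fun _ => a σ) (fun _ => h σ)) := by
    rw [hG.self_of_nhds, warpedMatrix]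
    norm_num
  simp only [curvatureForm, hG0, Matrix.diagonal_apply,
    curvatureCoeff_of_eventuallyEq_warpedMatrix hG ha ha₁ hh hh₁ ha0 hh0]
  simp only [warpedSectional, Fintype.sum_sum_type, Fin.sum_univ_two, Finset.univ_unique,
    Finset.sum_singleton, reduceCtorEq, if_false, Sum.inl.injEq, if_true,
    Sum.elim_inl, Sum.elim_inr, sub_zero, add_zero, zero_mul, mul_zero, zero_add, sub_self,
    zero_sub, zero_ne_one, one_ne_zero, PUnit.default_eq_unit]
  ring

end WarpedCurvature

end RiemCurv

/-! ### Differentiation under the integral sign on a compact space -/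

section ParametricIntegral

theorem hasDerivAt_integral_of_continuous {X : Type*} [TopologicalSpace X] [CompactSpace X]
    [MeasurableSpace X] [OpensMeasurableSpace X] {μ : Measure X} [IsFiniteMeasure μ]
    {F F' : ℝ → X → ℝ} (hF : ∀ t, Continuous (F t)) (hF' : Continuous (Function.uncurry F'))
    (hd : ∀ t x, HasDerivAt (fun s => F s x) (F' t x) t) (t : ℝ) :
    HasDerivAt (fun s => ∫ x, F s x ∂μ) (∫ x, F' t x ∂μ) t := by
  -- Compactness supplies a constant dominating function for parameters near t.
  obtain ⟨C, hC⟩ := ((isCompact_closedBall t 1).prod (isCompact_univ (X := X))).exists_bound_of_continuousOn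
    hF'.continuousOn
  have hint (s : ℝ) : Integrable (F s) μ :=
    (hF s).integrable_of_hasCompactSupport (HasCompactSupport.of_compactSpace _)
  have hF't : Continuous (F' t) := hF'.comp (Continuous.prodMk_right t)
  refine (hasDerivAt_integral_of_dominated_loc_of_deriv_le (bound := fun _ => C)
    (Metric.ball_mem_nhds t one_pos) (Filter.Eventually.of_forall fun s => (hint s).1) (hint t)
    (hF't.integrable_of_hasCompactSupport (HasCompactSupport.of_compactSpace _)).1
    (Filter.Eventually.of_forall fun x s hs => ?_) (integrable_const C)
    (Filter.Eventually.of_forall fun x s _ => hd s x)).2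
  exact hC (s, x) ⟨Metric.ball_subset_closedBall hs, Set.mem_univ x⟩

/-- If `∫ exp (A t)` does not depend on `t`, then its second derivative vanishes. -/
theorem integral_exp_second_deriv_eq_zero {X : Type*} [TopologicalSpace X] [CompactSpace X]
    [MeasurableSpace X] [OpensMeasurableSpace X] {μ : Measure X} [IsFiniteMeasure μ]
    {A A' A'' : ℝ → X → ℝ} (hA : Continuous (Function.uncurry A))
    (hA' : Continuous (Function.uncurry A')) (hA'' : Continuous (Function.uncurry A''))
    (hd : ∀ t x, HasDerivAt (fun s => A s x) (A' t x) t)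
    (hd' : ∀ t x, HasDerivAt (fun s => A' s x) (A'' t x) t)
    (hconst : ∀ t, ∫ x, Real.exp (A t x) ∂μ = ∫ x, Real.exp (A 0 x) ∂μ) (t : ℝ) :
    ∫ x, (A'' t x + A' t x ^ 2) * Real.exp (A t x) ∂μ = 0 := by
  have hE : Continuous (Function.uncurry fun t x => Real.exp (A t x)) := Real.continuous_exp.comp hA
  have h1 (t : ℝ) : ∫ x, A' t x * Real.exp (A t x) ∂μ = 0 := by
    have h := hasDerivAt_integral_of_continuous (μ := μ) (F := fun t x => Real.exp (A t x))
      (F' := fun t x => A' t x * Real.exp (A t x))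
      (fun t => hE.comp (Continuous.prodMk_right t)) (hA'.mul hE)
      (fun t x => by simpa only [mul_comm] using (hd t x).exp) t
    simp only [hconst] at h
    exact h.unique (hasDerivAt_const t _)
  have hc : Continuous (Function.uncurry fun t x => (A'' t x + A' t x ^ 2) * Real.exp (A t x)) := by
    simp only [Function.uncurry_def] at hA hA' hA'' ⊢
    fun_prop
  have h := hasDerivAt_integral_of_continuous (μ := μ) (F := fun t x => A' t x * Real.exp (A t x))
    (F' := fun t x => (A'' t x + A' t x ^ 2) * Real.exp (A t x))
    (fun t => (hA'.mul hE).comp (Continuous.prodMk_right t)) hc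
    (fun t x => by
      convert! (hd' t x).mul (hd t x).exp using 1
      ring) t
  simp only [h1] at h
  exact h.unique (hasDerivAt_const t _)

end ParametricIntegral

/-! ### Invariance of surface measure under linear isometries -/

section SphereInvariance

variable {E : Type*} [NormedAddCommGroup E] [InnerProductSpace ℝ E]

/-- The action of a linear isometry on the unit sphere. -/
def LinearIsometryEquiv.sphereMap (R : E ≃ₗᵢ[ℝ] E) (x : Metric.sphere (0 : E) 1) :
    Metric.sphere (0 : E) 1 :=
  ⟨R x, by simp⟩

theorem LinearIsometryEquiv.continuous_sphereMap (R : E ≃ₗᵢ[ℝ] E) : Continuous R.sphereMap :=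
  (R.continuous.comp continuous_subtype_val).subtype_mk _

variable [MeasurableSpace E] [BorelSpace E] [FiniteDimensional ℝ E]

open scoped Pointwise in
theorem LinearIsometryEquiv.measurePreserving_sphereMap (R : E ≃ₗᵢ[ℝ] E) :
    MeasurePreserving R.sphereMap (volume : Measure E).toSphere (volume : Measure E).toSphere := by
  refine ⟨R.continuous_sphereMap.measurable, ?_⟩
  ext s hs
  have hs' := R.continuous_sphereMap.measurable hs
  rw [Measure.map_apply R.continuous_sphereMap.measurable hs, Measure.toSphere_apply' _ hs,
    Measure.toSphere_apply' _ hs']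
  congr 1
  -- Surface measure is a multiple of the volume of the cone over a set; isometries map cones to
  -- cones and preserve volume.
  have e : (Set.Ioo (0 : ℝ) 1 • ((↑) '' (R.sphereMap ⁻¹' s)) : Set E)
      = R.toMeasurableEquiv ⁻¹' (Set.Ioo (0 : ℝ) 1 • ((↑) '' s)) := by
    ext x
    constructor
    · rintro ⟨r, hr, _, ⟨y, hy, rfl⟩, rfl⟩
      exact ⟨r, hr, _, ⟨_, hy, rfl⟩, by simp [sphereMap]⟩
    · rintro ⟨r, hr, _, ⟨y, hy, rfl⟩, hx⟩
      refine ⟨r, hr, _, ⟨R.symm.sphereMap y, ?_, rfl⟩, ?_⟩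
      · have hy' : R.sphereMap (R.symm.sphereMap y) = y := Subtype.ext (by simp [sphereMap])
        rwa [Set.mem_preimage, hy']
      · apply R.injective
        simpa [sphereMap] using hx
  rw [e, R.measurePreserving.measure_preimage_equiv]

theorem integral_toSphere_comp (R : E ≃ₗᵢ[ℝ] E) {f : E → ℝ} (hf : Continuous f) :
    ∫ x : Metric.sphere (0 : E) 1, f (R x) ∂(volume : Measure E).toSphere
      = ∫ x : Metric.sphere (0 : E) 1, f x ∂(volume : Measure E).toSphere := by
  have h := integral_map (μ := (volume : Measure E).toSphere) R.continuous_sphereMap.aemeasurable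
    (f := fun x : Metric.sphere (0 : E) 1 => f x)
    (hf.comp continuous_subtype_val).aestronglyMeasurable
  rw [R.measurePreserving_sphereMap.map_eq] at h
  exact h.symm

end SphereInvariance

/-! ### Exponential moments of the sphere -/

namespace VMF

open Real

/-- The ambient space `ℝ³`. -/
local notation "E3" => EuclideanSpace ℝ (Fin 3)

instance : IsFiniteMeasure area := inferInstanceAs (IsFiniteMeasure (Measure.toSphere _))

theorem integrable_area {f : S2 → ℝ} (hf : Continuous f) : Integrable f area :=
  hf.integrable_of_hasCompactSupport (HasCompactSupport.of_compactSpace _)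

theorem area_real_univ_pos : 0 < area.real Set.univ := by
  unfold area
  rw [Measure.toSphere_real_apply_univ]
  have : 0 < (volume : Measure E3).real (Metric.ball 0 1) :=
    ENNReal.toReal_pos (Metric.measure_ball_pos _ _ one_pos).ne' measure_ball_lt_top.ne
  simp only [finrank_euclideanSpace, Fintype.card_fin]
  positivity

theorem integral_area_comp (R : E3 ≃ₗᵢ[ℝ] E3) {f : E3 → ℝ} (hf : Continuous f) :
    ∫ x : S2, f (R x) ∂area = ∫ x : S2, f x ∂area :=
  integral_toSphere_comp R hf

/-- Odd moments in a direction orthogonal to `e` vanish. -/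
theorem integral_inner_mul_eq_zero {e ξ : E3} (h : inner ℝ e ξ = 0) {φ : ℝ → ℝ}
    (hφ : Continuous φ) : ∫ x : S2, inner ℝ (x : E3) ξ * φ (inner ℝ (x : E3) e) ∂area = 0 := by
  -- The reflection that sends ξ to -ξ fixes e, hence changes the sign of the integrand.
  have hi := integral_area_comp ((ℝ ∙ ξ)ᗮ.reflection)
    (f := fun x => inner ℝ x ξ * φ (inner ℝ x e)) (by fun_prop)
  have h1 : (ℝ ∙ ξ)ᗮ.reflection ξ = -ξ := Submodule.reflection_orthogonalComplement_singleton_eq_neg ξ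
  have h2 : (ℝ ∙ ξ)ᗮ.reflection e = e :=
    Submodule.reflection_mem_subspace_eq_self (Submodule.mem_orthogonal_singleton_iff_inner_left.2 h)
  have h3 (x y : E3) : inner ℝ ((ℝ ∙ ξ)ᗮ.reflection x) y = inner ℝ x ((ℝ ∙ ξ)ᗮ.reflection y) := by
    rw [← (ℝ ∙ ξ)ᗮ.reflection.inner_map_map, Submodule.reflection_reflection]
  simp only [h3, h1, h2, inner_neg_right, neg_mul, integral_neg] at hi
  linarith

/-- The Laplace transform of the surface area only depends on the norm. -/
theorem integral_exp_inner_eq {v w : E3} (h : ‖v‖ = ‖w‖) :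
    ∫ x : S2, exp (inner ℝ (x : E3) v) ∂area = ∫ x : S2, exp (inner ℝ (x : E3) w) ∂area := by
  have hi := integral_area_comp ((ℝ ∙ (v - w))ᗮ.reflection)
    (f := fun x => exp (inner ℝ x w)) (by fun_prop)
  rw [← hi]
  refine integral_congr_ae (Filter.Eventually.of_forall fun x => ?_)
  have h2 : (ℝ ∙ (v - w))ᗮ.reflection v = w := Submodule.reflection_sub h
  have := (ℝ ∙ (v - w))ᗮ.reflection.inner_map_map (x : E3) v
  rw [h2] at this
  simp only [this]

/-- By rotation invariance ∫ exp(σ⟨x, cos θ e + sin θ η⟩) is constant in θ. Its second derivative at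
θ = 0 is σ² times the tangential moment minus σ times the first moment. Dividing by σ forces the
case σ = 0 apart, where the first moment vanishes by symmetry. -/
theorem mul_integral_inner_sq_mul_exp {e η : E3} (he : ‖e‖ = 1) (hη : ‖η‖ = 1)
    (h : inner ℝ e η = 0) (σ : ℝ) :
    σ * ∫ x : S2, inner ℝ (x : E3) η ^ 2 * exp (σ * inner ℝ (x : E3) e) ∂area
      = ∫ x : S2, inner ℝ (x : E3) e * exp (σ * inner ℝ (x : E3) e) ∂area := by
  rcases eq_or_ne σ 0 with rfl | hσ
  · have := integral_inner_mul_eq_zero (e := 0) (ξ := e) (by simp) (φ := fun _ => 1)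
      continuous_const
    simpa using this.symm
  have hconst (θ : ℝ) :
      ∫ x : S2, exp (σ * cos θ * inner ℝ (x : E3) e + σ * sin θ * inner ℝ (x : E3) η) ∂area
      = ∫ x : S2, exp (σ * cos 0 * inner ℝ (x : E3) e + σ * sin 0 * inner ℝ (x : E3) η) ∂area := by
    have hn (θ : ℝ) : ‖(σ * cos θ) • e + (σ * sin θ) • η‖ = |σ| := by
      refine (sq_eq_sq₀ (norm_nonneg _) (abs_nonneg _)).1 ?_
      rw [norm_add_sq_real, norm_smul, norm_smul, real_inner_smul_left, real_inner_smul_right, h,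
        he, hη, sq_abs]
      simp only [norm_eq_abs, mul_one, mul_zero, add_zero, sq_abs]
      linear_combination σ ^ 2 * sin_sq_add_cos_sq θ
    have := integral_exp_inner_eq ((hn θ).trans (hn 0).symm)
    simpa only [inner_add_right, real_inner_smul_right] using this
  have h3 := integral_exp_second_deriv_eq_zero (μ := area)
    (A := fun θ (x : S2) => σ * cos θ * inner ℝ (x : E3) e + σ * sin θ * inner ℝ (x : E3) η)
    (A' := fun θ (x : S2) => σ * -sin θ * inner ℝ (x : E3) e + σ * cos θ * inner ℝ (x : E3) η)
    (A'' := fun θ (x : S2) => σ * -cos θ * inner ℝ (x : E3) e + σ * -sin θ * inner ℝ (x : E3) η)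
    (by simp only [Function.uncurry_def]; fun_prop) (by simp only [Function.uncurry_def]; fun_prop)
    (by simp only [Function.uncurry_def]; fun_prop)
    (fun θ x => (((hasDerivAt_cos θ).const_mul σ).mul_const _).add
      (((hasDerivAt_sin θ).const_mul σ).mul_const _))
    (fun θ x => (((hasDerivAt_sin θ).neg.const_mul σ).mul_const _).add
      (((hasDerivAt_cos θ).const_mul σ).mul_const _)) hconst 0
  simp only [cos_zero, sin_zero, mul_one, mul_zero, zero_mul, add_zero, neg_zero, zero_add] at h3
  have h4 : ∫ x : S2, (σ ^ 2 * (inner ℝ (x : E3) η ^ 2 * exp (σ * inner ℝ (x : E3) e))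
      - σ * (inner ℝ (x : E3) e * exp (σ * inner ℝ (x : E3) e))) ∂area = 0 := by
    rw [← h3]
    refine integral_congr_ae (Filter.Eventually.of_forall fun x => ?_)
    simp only
    ring
  rw [integral_sub (integrable_area (by fun_prop)) (integrable_area (by fun_prop)),
    integral_const_mul, integral_const_mul] at h4
  refine mul_left_cancel₀ hσ ?_
  linear_combination h4

/-- The moments `∫ tᵏ exp (σ t)` of `t = ⟨x, e⟩` on the sphere. -/
def sphereMoment (e : E3) (k : ℕ) (σ : ℝ) : ℝ :=
  ∫ x : S2, inner ℝ (x : E3) e ^ k * exp (σ * inner ℝ (x : E3) e) ∂area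

theorem mul_integral_inner_sq {e ξ : E3} (he : ‖e‖ = 1) (h : inner ℝ e ξ = 0) (σ : ℝ) :
    σ * ∫ x : S2, inner ℝ (x : E3) ξ ^ 2 * exp (σ * inner ℝ (x : E3) e) ∂area
      = ‖ξ‖ ^ 2 * sphereMoment e 1 σ := by
  rcases eq_or_ne ξ 0 with rfl | hξ
  · simp
  have hn : ‖ξ‖ ≠ 0 := norm_ne_zero_iff.2 hξ
  have h1 := mul_integral_inner_sq_mul_exp he (η := ‖ξ‖⁻¹ • ξ) (by simp [norm_smul, hn])
    (by rw [inner_smul_right, h, mul_zero]) σ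
  simp only [inner_smul_right, mul_pow, mul_assoc, integral_const_mul] at h1
  simp only [sphereMoment, pow_one, ← h1]
  field_simp

theorem mul_integral_inner_mul_inner {e ξ η : E3} (he : ‖e‖ = 1) (hξ : inner ℝ e ξ = 0)
    (hη : inner ℝ e η = 0) (σ : ℝ) :
    σ * ∫ x : S2, inner ℝ (x : E3) ξ * inner ℝ (x : E3) η * exp (σ * inner ℝ (x : E3) e) ∂area
      = inner ℝ ξ η * sphereMoment e 1 σ := by
  have h1 := mul_integral_inner_sq he hξ σ
  have h2 := mul_integral_inner_sq he hη σ
  have h3 := mul_integral_inner_sq he (ξ := ξ + η) (by rw [inner_add_right, hξ, hη, add_zero]) σ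
  have e1 : ∫ x : S2, inner ℝ (x : E3) (ξ + η) ^ 2 * exp (σ * inner ℝ (x : E3) e) ∂area
      = ∫ x : S2, inner ℝ (x : E3) ξ ^ 2 * exp (σ * inner ℝ (x : E3) e) ∂area
        + ∫ x : S2, inner ℝ (x : E3) η ^ 2 * exp (σ * inner ℝ (x : E3) e) ∂area
        + 2 * ∫ x : S2, inner ℝ (x : E3) ξ * inner ℝ (x : E3) η
            * exp (σ * inner ℝ (x : E3) e) ∂area := by
    rw [← integral_const_mul, ← integral_add (integrable_area (by fun_prop))
      (integrable_area (by fun_prop)), ← integral_add (integrable_area (by fun_prop))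
      (integrable_area (by fun_prop))]
    refine integral_congr_ae (Filter.Eventually.of_forall fun x => ?_)
    simp only [inner_add_right]
    ring
  rw [e1, norm_add_sq_real] at h3
  linear_combination (h3 - h1 - h2) / 2

/-- On the sphere 1 - ⟨x, e⟩² = ∑ ⟨x, ξ_i⟩², where the ξ_i are the projections of the standard basis
to e^⊥. Their squared norms 1 - e_i² add up to 2. -/
theorem mul_sphereMoment_zero_sub_two {e : E3} (he : ‖e‖ = 1) (σ : ℝ) :
    σ * (sphereMoment e 0 σ - sphereMoment e 2 σ) = 2 * sphereMoment e 1 σ := by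
  set ξ : Fin 3 → E3 := fun i => EuclideanSpace.single i 1 - e i • e with hξdef
  have hee : inner ℝ e e = 1 := by rw [real_inner_self_eq_norm_sq, he, one_pow]
  have hin (x : E3) (i : Fin 3) : inner ℝ x (ξ i) = x i - e i * inner ℝ x e := by
    simp [hξdef, inner_sub_right, inner_smul_right, EuclideanSpace.inner_single_right]
  have horth (i) : inner ℝ e (ξ i) = 0 := by rw [hin, hee, mul_one, sub_self]
  have h (i) := mul_integral_inner_sq he (horth i) σ
  have hnorm (i) : ‖ξ i‖ ^ 2 = 1 - e i ^ 2 := by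
    rw [← real_inner_self_eq_norm_sq, hin]
    nth_rewrite 1 [real_inner_comm]
    rw [horth i]
    simp [hξdef]
    ring
  have hsq (x : E3) : ‖x‖ ^ 2 = x 0 ^ 2 + x 1 ^ 2 + x 2 ^ 2 := by
    rw [EuclideanSpace.real_norm_sq_eq, Fin.sum_univ_three]
  have hxe (x : E3) : inner ℝ x e = x 0 * e 0 + x 1 * e 1 + x 2 * e 2 := by
    simp [PiLp.inner_apply, Fin.sum_univ_three, mul_comm]
  have he3 := hsq e
  rw [he] at he3
  have e1 : sphereMoment e 0 σ - sphereMoment e 2 σ = ∑ i, ∫ x : S2, inner ℝ (x : E3) (ξ i) ^ 2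
      * exp (σ * inner ℝ (x : E3) e) ∂area := by
    rw [sphereMoment, sphereMoment, ← integral_sub (integrable_area (by fun_prop))
      (integrable_area (by fun_prop)), ← integral_finsetSum _
      fun i _ => integrable_area (by fun_prop)]
    refine integral_congr_ae (Filter.Eventually.of_forall fun x => ?_)
    have hx := hsq x
    rw [norm_eq_of_mem_sphere x] at hx
    have hxe' := hxe x
    simp only [hin, Fin.sum_univ_three]
    generalize inner ℝ (x : E3) e = t at *
    linear_combination exp (σ * t) * (hx - 2 * t * hxe' + t ^ 2 * he3)
  rw [e1, Finset.mul_sum]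
  simp only [h, hnorm, Fin.sum_univ_three]
  linear_combination sphereMoment e 1 σ * he3

theorem hasDerivAt_sphereMoment (e : E3) (k : ℕ) (σ : ℝ) :
    HasDerivAt (sphereMoment e k) (sphereMoment e (k + 1) σ) σ := by
  refine hasDerivAt_integral_of_continuous (μ := area)
    (F := fun σ (x : S2) => inner ℝ (x : E3) e ^ k * exp (σ * inner ℝ (x : E3) e))
    (F' := fun σ (x : S2) => inner ℝ (x : E3) e ^ (k + 1) * exp (σ * inner ℝ (x : E3) e))
    (fun t => by fun_prop) (by simp only [Function.uncurry_def]; fun_prop) (fun t x => ?_) σ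
  have := (((hasDerivAt_id t).mul_const (inner ℝ (x : E3) e)).exp).const_mul (inner ℝ (x : E3) e ^ k)
  convert! this using 1
  simp only [id]
  ring

/-- With m₀ the zeroth moment, y(σ) = σ m₀(σ) solves y'' = y with y(0) = 0 and y'(0) equal to the
total area, whose value is never needed. -/
theorem mul_sphereMoment_zero {e : E3} (he : ‖e‖ = 1) (σ : ℝ) :
    σ * sphereMoment e 0 σ = area.real Set.univ * sinh σ ∧
      sphereMoment e 0 σ + σ * sphereMoment e 1 σ = area.real Set.univ * cosh σ := by
  have hy (t : ℝ) : HasDerivAt (fun t => t * sphereMoment e 0 t)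
      (sphereMoment e 0 t + t * sphereMoment e 1 t) t := by
    convert! (hasDerivAt_id t).mul (hasDerivAt_sphereMoment e 0 t) using 1
    simp
  have hy' (t : ℝ) : HasDerivAt (fun t => sphereMoment e 0 t + t * sphereMoment e 1 t)
      (t * sphereMoment e 0 t) t := by
    convert! (hasDerivAt_sphereMoment e 0 t).add
      ((hasDerivAt_id t).mul (hasDerivAt_sphereMoment e 1 t)) using 1
    simp only [id]
    linear_combination mul_sphereMoment_zero_sub_two he t
  have h0 : sphereMoment e 0 0 = area.real Set.univ := by simp [sphereMoment]
  -- The first integrals (y' - y)eᵗ and (y' + y)e⁻ᵗ of y'' = y replace a uniqueness theorem.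
  have c1 (t : ℝ) : HasDerivAt (fun t => (sphereMoment e 0 t + t * sphereMoment e 1 t
      - t * sphereMoment e 0 t) * exp t) 0 t := by
    convert! ((hy' t).sub (hy t)).mul (hasDerivAt_exp t) using 1
    simp only [Pi.sub_apply]
    ring
  have c2 (t : ℝ) : HasDerivAt (fun t => (sphereMoment e 0 t + t * sphereMoment e 1 t
      + t * sphereMoment e 0 t) * exp (-t)) 0 t := by
    convert! ((hy' t).add (hy t)).mul (hasDerivAt_neg t).exp using 1
    simp only [Pi.add_apply]
    ring
  have d1 := is_const_of_deriv_eq_zero (fun t => (c1 t).differentiableAt) (fun t => (c1 t).deriv) σ 0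
  have d2 := is_const_of_deriv_eq_zero (fun t => (c2 t).differentiableAt) (fun t => (c2 t).deriv) σ 0
  simp only [h0, zero_mul, add_zero, sub_zero, exp_zero, mul_one, neg_zero] at d1 d2
  have hm : exp σ * exp (-σ) = 1 := by rw [← exp_add]; simp
  rw [sinh_eq, cosh_eq]
  generalize area.real Set.univ = C at *
  generalize exp σ = a at *
  generalize exp (-σ) = b at *
  constructor
  · linear_combination (a * d2 - b * d1) / 2 - σ * sphereMoment e 0 σ * hm
  · linear_combination (a * d2 + b * d1) / 2
      - (sphereMoment e 0 σ + σ * sphereMoment e 1 σ) * hm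

end VMF

/-- The target has the model of the vector space F × F', not the product model, so Fréchet
derivatives on F × F' can be composed with it. -/
theorem HasMFDerivAt.prodMk_vector {E : Type*} [NormedAddCommGroup E] [NormedSpace ℝ E]
    {H : Type*} [TopologicalSpace H] {I : ModelWithCorners ℝ E H}
    {M : Type*} [TopologicalSpace M] [ChartedSpace H M]
    {F F' : Type*} [NormedAddCommGroup F] [NormedSpace ℝ F]
    [NormedAddCommGroup F'] [NormedSpace ℝ F'] {f : M → F} {g : M → F'} {x : M}
    {df : TangentSpace I x →L[ℝ] F} {dg : TangentSpace I x →L[ℝ] F'}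
    (hf : HasMFDerivAt I 𝓘(ℝ, F) f x df) (hg : HasMFDerivAt I 𝓘(ℝ, F') g x dg) :
    HasMFDerivAt I 𝓘(ℝ, F × F') (fun y => (f y, g y)) x (df.prod dg) :=
  ⟨hf.1.prodMk hg.1, hf.2.prodMk hg.2⟩

/-! ### Score and Fisher information -/

namespace VMF

open Real

local notation "E3" => EuclideanSpace ℝ (Fin 3)

theorem norm_coe_sphere (x : S2) : ‖(x : E3)‖ = 1 := norm_eq_of_mem_sphere x

theorem sphereMoment_zero_eq (x : S2) {σ : ℝ} (hσ : 0 < σ) :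
    sphereMoment x 0 σ = area.real Set.univ * sinh σ / σ := by
  rw [eq_div_iff hσ.ne', mul_comm, (mul_sphereMoment_zero (norm_coe_sphere x) σ).1]

theorem sphereMoment_zero_pos (x : S2) {σ : ℝ} (hσ : 0 < σ) : 0 < sphereMoment x 0 σ := by
  rw [sphereMoment_zero_eq x hσ]
  exact div_pos (mul_pos area_real_univ_pos (sinh_pos_iff.2 hσ)) hσ

theorem density_eq (z : Param) (x : S2) :
    density z x = exp ((z.2 : ℝ) * inner ℝ (x : E3) z.1) / sphereMoment z.1 0 z.2 := by
  simp [density, sphereMoment]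

theorem density_pos (z : Param) (x : S2) : 0 < density z x := by
  rw [density_eq]
  exact div_pos (exp_pos _) (sphereMoment_zero_pos z.1 z.2.2)

theorem continuous_density (z : Param) : Continuous (density z) := by
  rw [show density z = _ from funext (density_eq z)]
  fun_prop

theorem integral_density (z : Param) : ∫ x, density z x ∂area = 1 := by
  simp only [density_eq, integral_div]
  have := (sphereMoment_zero_pos z.1 z.2.2).ne'
  rw [div_eq_one_iff_eq this]
  simp [sphereMoment]

/-- The inclusion of the sphere, as a function on the parameter manifold. -/
def meanDirection (w : Param) : E3 := w.1

theorem contMDiff_meanDirection : ContMDiff J 𝓘(ℝ, E3) ∞ meanDirection :=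
  haveI : Fact (finrank ℝ E3 = 2 + 1) := ⟨finrank_euclideanSpace_fin⟩
  (contMDiff_coe_sphere (E := E3) (n := 2)).comp contMDiff_fst

/-- The concentration, as a function on the parameter manifold. -/
def concentration (w : Param) : ℝ := w.2

theorem contMDiff_concentration : ContMDiff J 𝓘(ℝ, ℝ) ∞ concentration :=
  contMDiff_subtype_val.comp contMDiff_snd

/-- Logarithm of the normalising constant. -/
def logPartition (σ : ℝ) : ℝ := log (area.real Set.univ * sinh σ / σ)

theorem hasDerivAt_logPartition {σ : ℝ} (hσ : 0 < σ) :
    HasDerivAt logPartition (I₁ σ / σ) σ := by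
  have hs := sinh_pos_iff.2 hσ
  have hC := area_real_univ_pos
  have h := (((hasDerivAt_sinh σ).const_mul (area.real Set.univ)).div (hasDerivAt_id σ) hσ.ne').log
    (by simp only [id, Pi.div_apply]; positivity)
  convert! h using 1
  simp only [id, I₁, Pi.div_apply]
  field_simp

theorem log_density (z : Param) (x : S2) : log (density z x) =
    concentration z * inner ℝ (x : E3) (meanDirection z) - logPartition (concentration z) := by
  rw [density_eq, log_div (exp_pos _).ne' (sphereMoment_zero_pos z.1 z.2.2).ne', log_exp,
    sphereMoment_zero_eq z.1 z.2.2]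
  rfl

theorem hasMFDerivAt_log_density (z : Param) (x : S2) :
    HasMFDerivAt J 𝓘(ℝ, ℝ) (fun w => log (density w x)) z
      ((inner ℝ (x : E3) z.1 - I₁ z.2 / z.2) • mvfderiv J concentration z
        + (z.2 : ℝ) • (innerSL ℝ (x : E3) ∘L mvfderiv J meanDirection z)) := by
  have h1 := (contMDiff_meanDirection.mdifferentiable (by simp) z).hasMFDerivAt
  have h2 := (contMDiff_concentration.mdifferentiable (by simp) z).hasMFDerivAt
  have hψ := hasDerivAt_logPartition z.2.2
  have hΦ : HasFDerivAt (fun y : E3 × ℝ => y.2 * inner ℝ (x : E3) y.1 - logPartition y.2)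
      ((inner ℝ (x : E3) z.1 - I₁ z.2 / z.2) • ContinuousLinearMap.snd ℝ E3 ℝ
        + (z.2 : ℝ) • (innerSL ℝ (x : E3) ∘L ContinuousLinearMap.fst ℝ E3 ℝ))
      (meanDirection z, concentration z) := by
    have a1 : HasFDerivAt (fun y : E3 × ℝ => inner ℝ (x : E3) y.1)
        (innerSL ℝ (x : E3) ∘L ContinuousLinearMap.fst ℝ E3 ℝ)
        (meanDirection z, concentration z) :=
      (innerSL ℝ (x : E3) ∘L ContinuousLinearMap.fst ℝ E3 ℝ).hasFDerivAt
    have a2 : HasFDerivAt (fun y : E3 × ℝ => y.2) (ContinuousLinearMap.snd ℝ E3 ℝ)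
        (meanDirection z, concentration z) := hasFDerivAt_snd
    have a3 := hψ.comp_hasFDerivAt (f := fun y : E3 × ℝ => y.2)
      (meanDirection z, concentration z) a2
    convert! (a2.mul a1).sub a3 using 1
    ext y <;> simp [meanDirection, concentration]
  have h3 := hΦ.hasMFDerivAt.comp z (h1.prodMk_vector h2)
  have e : (fun w => log (density w x)) =
      (fun y : E3 × ℝ => y.2 * inner ℝ (x : E3) y.1 - logPartition y.2) ∘
        fun w => (meanDirection w, concentration w) := funext fun w => log_density w x
  rw [e]
  exact h3

theorem score_eq (z : Param) (u : TangentSpace J z) (x : S2) :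
    score J density z u x = (inner ℝ (x : E3) z.1 - I₁ z.2 / z.2) * dσ z u
      + (z.2 : ℝ) * inner ℝ (x : E3) (mvfderiv J meanDirection z u) := by
  rw [score, mvfderiv, (hasMFDerivAt_log_density z x).mfderiv]
  rfl

/-- Differentiate ‖x̄‖² = 1. -/
theorem inner_mvfderiv_meanDirection (z : Param) (u : TangentSpace J z) :
    inner ℝ (z.1 : E3) (mvfderiv J meanDirection z u) = 0 := by
  have h1 := (contMDiff_meanDirection.mdifferentiable (by simp) z).hasMFDerivAt
  have hq : HasFDerivAt (fun y : E3 => ‖y‖ ^ 2) (2 • innerSL ℝ (meanDirection z))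
      (meanDirection z) := (hasStrictFDerivAt_norm_sq _).hasFDerivAt
  have h2 := hq.hasMFDerivAt.comp z h1
  have e : (fun y : E3 => ‖y‖ ^ 2) ∘ meanDirection = fun _ => 1 := by
    funext w
    simp [meanDirection]
  rw [e] at h2
  have h3 := hasMFDerivAt_unique h2 (hasMFDerivAt_const (I := J) (I' := 𝓘(ℝ, ℝ)) 1 z)
  have h4 : 2 • inner ℝ (z.1 : E3) (mvfderiv J meanDirection z u) = 0 := congrArg (fun f => f u) h3
  simpa using h4

/-- In the product of the two scores, the terms of degree one in ξ or η integrate to zero. The dσ²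
coefficient is the variance of ⟨x, x̄⟩, and the tangential moment gives the dθ² coefficient. -/
theorem fisherForm_eq (z : Param) (u v : TangentSpace J z) :
    fisherForm J area density z u v =
      I₀ z.2 * (dσ z u * dσ z v) + I₁ z.2 * dθsq z u v := by
  have hσ : (0 : ℝ) < z.2 := z.2.2
  have hu := inner_mvfderiv_meanDirection z u
  have hv := inner_mvfderiv_meanDirection z v
  have he := norm_coe_sphere z.1
  have hd : dθsq z u v = inner ℝ (mvfderiv J meanDirection z u) (mvfderiv J meanDirection z v) := rfl
  simp only [fisherForm, score_eq, density_eq, hd]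
  generalize mvfderiv J meanDirection z u = ξ at *
  generalize mvfderiv J meanDirection z v = η at *
  generalize dσ z u = p at *
  generalize dσ z v = q at *
  have hZ := sphereMoment_zero_pos z.1 hσ
  have m01 := mul_sphereMoment_zero he (z.2 : ℝ)
  have m2 := mul_sphereMoment_zero_sub_two he (z.2 : ℝ)
  have mξη := mul_integral_inner_mul_inner he hu hv (z.2 : ℝ)
  have hE (t : ℝ) : Continuous fun t : ℝ => (t - I₁ z.2 / z.2) * exp (z.2 * t) := by fun_prop
  have oξ := integral_inner_mul_eq_zero hu (hE 0)
  have oη := integral_inner_mul_eq_zero hv (hE 0)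
  set e : E3 := (z.1 : E3)
  set σ : ℝ := (z.2 : ℝ)
  set c : ℝ := I₁ σ / σ with hc
  have key : ∫ x : S2, ((inner ℝ (x : E3) e - c) * p + σ * inner ℝ (x : E3) ξ)
      * ((inner ℝ (x : E3) e - c) * q + σ * inner ℝ (x : E3) η)
      * (exp (σ * inner ℝ (x : E3) e) / sphereMoment e 0 σ) ∂area
      = (p * q * (sphereMoment e 2 σ - 2 * c * sphereMoment e 1 σ + c ^ 2 * sphereMoment e 0 σ)
        + σ ^ 2 * ∫ x : S2, inner ℝ (x : E3) ξ * inner ℝ (x : E3) η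
            * exp (σ * inner ℝ (x : E3) e) ∂area) / sphereMoment e 0 σ := by
    have e1 : ∀ x : S2, ((inner ℝ (x : E3) e - c) * p + σ * inner ℝ (x : E3) ξ)
      * ((inner ℝ (x : E3) e - c) * q + σ * inner ℝ (x : E3) η)
      * (exp (σ * inner ℝ (x : E3) e) / sphereMoment e 0 σ) =
      (p * q * (inner ℝ (x : E3) e ^ 2 * exp (σ * inner ℝ (x : E3) e)
        - 2 * c * (inner ℝ (x : E3) e ^ 1 * exp (σ * inner ℝ (x : E3) e))
        + c ^ 2 * (inner ℝ (x : E3) e ^ 0 * exp (σ * inner ℝ (x : E3) e)))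
      + σ ^ 2 * (inner ℝ (x : E3) ξ * inner ℝ (x : E3) η * exp (σ * inner ℝ (x : E3) e))
      + σ * q * (inner ℝ (x : E3) ξ * ((inner ℝ (x : E3) e - c) * exp (σ * inner ℝ (x : E3) e)))
      + σ * p * (inner ℝ (x : E3) η * ((inner ℝ (x : E3) e - c) * exp (σ * inner ℝ (x : E3) e))))
        / sphereMoment e 0 σ := fun x => by ring
    simp only [e1]
    rw [integral_div, integral_add (integrable_area (by fun_prop)) (integrable_area (by fun_prop)),
      integral_add (integrable_area (by fun_prop)) (integrable_area (by fun_prop)),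
      integral_add (integrable_area (by fun_prop)) (integrable_area (by fun_prop)),
      integral_const_mul, integral_const_mul, integral_const_mul, integral_const_mul, oξ, oη,
      integral_add (integrable_area (by fun_prop)) (integrable_area (by fun_prop)),
      integral_sub (integrable_area (by fun_prop)) (integrable_area (by fun_prop)),
      integral_const_mul, integral_const_mul, mul_zero, mul_zero, add_zero, add_zero]
    rfl
  rw [key]
  generalize ∫ x : S2, inner ℝ (x : E3) ξ * inner ℝ (x : E3) η
            * exp (σ * inner ℝ (x : E3) e) ∂area = Q at *
  generalize sphereMoment e 0 σ = A at *
  generalize sphereMoment e 1 σ = B at *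
  generalize sphereMoment e 2 σ = D at *
  obtain ⟨m0, m1⟩ := m01
  have hs := sinh_pos_iff.2 hσ
  have hC := area_real_univ_pos
  generalize area.real Set.univ = C at *
  have hA : A = C * sinh σ / σ := by field_simp; linear_combination m0
  -- Mean c = I₁/σ, then second moment 1 - 2c/σ; `hI0` identifies the variance 1 - 2c/σ - c² with
  -- I₀.
  have hB : B = c * A := by
    rw [hA, hc, I₁]
    have : σ * B = C * cosh σ - A := by linear_combination m1
    rw [hA] at this
    field_simp at this ⊢
    linear_combination this
  have hD : D = A * (1 - 2 * c / σ) := by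
    rw [hB] at m2
    field_simp
    linear_combination -m2
  have hQ : Q = inner ℝ ξ η * c * A / σ := by
    rw [hB] at mξη
    field_simp
    linear_combination mξη
  have hI0 : I₀ σ = 1 - 2 * c / σ - c ^ 2 := by
    rw [hc, I₀, I₁]
    field_simp
    linear_combination σ ^ 2 * cosh_sq σ
  rw [hD, hB, hQ, hI0]
  have hI1 : I₁ σ = c * σ := by rw [hc]; field_simp
  rw [hI1]
  field_simp
  ring

theorem integrable_score_mul_score (z : Param) (u v : TangentSpace J z) :
    Integrable (fun x => score J density z u x * score J density z v x * density z x) area := by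
  simp only [score_eq]
  have := continuous_density z
  exact integrable_area (by fun_prop)

end VMF

/-! ### Smoothness of metrics pulled back from smooth functions -/

section PulledBackForm

/-- The bilinear form `a ⟨A u, A v⟩ + c (B u) (B v)`. -/
def pulledBackForm {V W : Type*} [NormedAddCommGroup V] [NormedSpace ℝ V] [NormedAddCommGroup W]
    [InnerProductSpace ℝ W] (a c : ℝ) (A : V →L[ℝ] W) (B : V →L[ℝ] ℝ) : V →L[ℝ] V →L[ℝ] ℝ :=
  a • ((ContinuousLinearMap.compL ℝ V W ℝ).flip A ∘L (innerSL ℝ ∘L A)) + c • B.smulRight B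

variable {V W : Type*} [NormedAddCommGroup V] [NormedSpace ℝ V] [NormedAddCommGroup W]
    [InnerProductSpace ℝ W]

set_option synthInstance.maxHeartbeats 200000 in
theorem contDiff_pulledBackForm :
    ContDiff ℝ ∞ (fun q : (ℝ × ℝ) × ((V →L[ℝ] W) × (V →L[ℝ] ℝ)) =>
        pulledBackForm q.1.1 q.1.2 q.2.1 q.2.2) := by
  have h1 : ContDiff ℝ ∞ (fun q : (ℝ × ℝ) × ((V →L[ℝ] W) × (V →L[ℝ] ℝ)) =>
      (ContinuousLinearMap.compL ℝ V W ℝ).flip q.2.1 ∘L (innerSL ℝ ∘L q.2.1)) :=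
    ((ContinuousLinearMap.compL ℝ V W ℝ).flip.contDiff.comp contDiff_snd.fst).clm_comp
      (contDiff_const.clm_comp contDiff_snd.fst)
  have h2 : ContDiff ℝ ∞ (fun q : (ℝ × ℝ) × ((V →L[ℝ] W) × (V →L[ℝ] ℝ)) =>
      q.2.2.smulRight q.2.2) := contDiff_snd.snd.smulRight contDiff_snd.snd
  exact (contDiff_fst.fst.smul h1).add (contDiff_fst.snd.smul h2)

variable {H : Type*} [TopologicalSpace H] {I : ModelWithCorners ℝ V H}
    {M : Type*} [TopologicalSpace M] [ChartedSpace H M] [IsManifold I ∞ M]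

/-- The differential of a smooth vector-valued function, read in the trivialization of the tangent
bundle at `z₀`, is smooth. -/
theorem ContMDiff.contMDiffAt_mvfderiv_comp_symmL {F : Type*} [NormedAddCommGroup F]
    [NormedSpace ℝ F] {f : M → F} (hf : ContMDiff I 𝓘(ℝ, F) ∞ f) (z₀ : M) :
    ContMDiffAt I 𝓘(ℝ, V →L[ℝ] F) ∞
      (fun z => (mvfderiv I f z ∘L (trivializationAt V (TangentSpace I) z₀).symmL ℝ z : V →L[ℝ] F))
      z₀ := by
  have h := (hf z₀).mfderiv_const (m := ∞) (by norm_num)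
  refine h.congr_of_eventuallyEq (Filter.Eventually.of_forall fun z => ?_)
  refine ContinuousLinearMap.ext fun v => ?_
  simp only [inTangentCoordinates, ContinuousLinearMap.inCoordinates, id,
    TangentBundle.continuousLinearMapAt_model_space]
  rfl

/-- The form `a ⟨df, df⟩ + c dg²`, at a point of a manifold. -/
def pulledBackMetric (I : ModelWithCorners ℝ V H) (a c : M → ℝ) (f : M → W) (g : M → ℝ) (z : M) :
    TangentSpace I z →L[ℝ] TangentSpace I z →L[ℝ] ℝ :=
  pulledBackForm (V := V) (a z) (c z) (mvfderiv I f z) (mvfderiv I g z)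

/-- Read in a trivialization, the form is `pulledBackForm` of the coefficients and of the
trivialized differentials of f and g: a smooth map applied to smooth arguments. -/
theorem contMDiff_pulledBackMetric {a c : M → ℝ} {f : M → W} {g : M → ℝ}
    (ha : ContMDiff I 𝓘(ℝ, ℝ) ∞ a) (hc : ContMDiff I 𝓘(ℝ, ℝ) ∞ c)
    (hf : ContMDiff I 𝓘(ℝ, W) ∞ f) (hg : ContMDiff I 𝓘(ℝ, ℝ) ∞ g) :
    ContMDiff I (I.prod 𝓘(ℝ, V →L[ℝ] V →L[ℝ] ℝ)) ∞
      (fun z => Bundle.TotalSpace.mk' (V →L[ℝ] V →L[ℝ] ℝ)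
        (E := fun z : M => TangentSpace I z →L[ℝ] TangentSpace I z →L[ℝ] ℝ) z
        (pulledBackMetric I a c f g z)) := by
  intro z₀
  refine (contMDiffAt_hom_bundle _).2 ⟨contMDiffAt_id, ?_⟩
  have hA := hf.contMDiffAt_mvfderiv_comp_symmL z₀
  have hB := hg.contMDiffAt_mvfderiv_comp_symmL z₀
  have h := contDiff_pulledBackForm.contDiffAt.contMDiffAt.comp z₀
    (((ha z₀).prodMk_space (hc z₀)).prodMk_space (hA.prodMk_space hB))
  refine h.congr_of_eventuallyEq ?_
  have hbase := (trivializationAt V (TangentSpace I) z₀).open_baseSet.mem_nhds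
    (FiberBundle.mem_baseSet_trivializationAt' z₀)
  filter_upwards [hbase] with z hz
  refine ContinuousLinearMap.ext fun u => ContinuousLinearMap.ext fun v => ?_
  refine (inCoordinates_apply_eq₂ hz hz (Set.mem_univ z)).trans ?_
  simp only [Bundle.Trivial.fiberBundle_trivializationAt', Bundle.Trivial.linearMapAt_trivialization]
  rw [← Bundle.Trivialization.symmL_apply (R := ℝ) _ hz u,
    ← Bundle.Trivialization.symmL_apply (R := ℝ) _ hz v]
  rfl

end PulledBackForm

/-! ### The Rao–Fisher form as a smooth tensor, and the stereographic chart -/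

namespace VMF

local notation "E3" => EuclideanSpace ℝ (Fin 3)
local notation "E21" => EuclideanSpace ℝ (Fin 2) × ℝ

theorem contMDiff_I₀_concentration : ContMDiff J 𝓘(ℝ, ℝ) ∞ fun z => I₀ (concentration z) :=
  fun z => (contDiffAt_I₀ z.2.2).contMDiffAt.comp z (contMDiff_concentration z)

theorem contMDiff_I₁_concentration : ContMDiff J 𝓘(ℝ, ℝ) ∞ fun z => I₁ (concentration z) :=
  fun z => (contDiffAt_I₁ z.2.2).contMDiffAt.comp z (contMDiff_concentration z)

/-- The Rao–Fisher metric as a continuous bilinear form on the tangent space. -/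
def fisherInner (z : Param) : TangentSpace J z →L[ℝ] TangentSpace J z →L[ℝ] ℝ :=
  pulledBackMetric J (fun z => I₁ (concentration z)) (fun z => I₀ (concentration z))
    meanDirection concentration z

theorem fisherInner_apply (z : Param) (u v : TangentSpace J z) :
    fisherInner z u v = I₀ z.2 * (dσ z u * dσ z v) + I₁ z.2 * dθsq z u v :=
  add_comm _ _

theorem contMDiff_fisherInner :
    ContMDiff J (J.prod 𝓘(ℝ, E21 →L[ℝ] E21 →L[ℝ] ℝ)) ∞
      (fun z => Bundle.TotalSpace.mk' (E21 →L[ℝ] E21 →L[ℝ] ℝ)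
        (E := fun z : Param => TangentSpace J z →L[ℝ] TangentSpace J z →L[ℝ] ℝ) z
        (fisherInner z)) :=
  contMDiff_pulledBackMetric contMDiff_I₁_concentration contMDiff_I₀_concentration
    contMDiff_meanDirection contMDiff_concentration

theorem extChartAt_snd (p z : Param) : (extChartAt J p z).2 = z.2 := by
  simp
  rfl

theorem extChartAt_self (p : Param) : extChartAt J p p = (0, (p.2 : ℝ)) := by
  refine Prod.ext ?_ (extChartAt_snd p p)
  have : Fact (finrank ℝ E3 = 2 + 1) := ⟨finrank_euclideanSpace_fin⟩
  change (OrthonormalBasis.fromOrthogonalSpanSingleton (𝕜 := ℝ) 2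
    (ne_zero_of_mem_unit_sphere (-p.1))).repr (stereographic (norm_eq_of_mem_sphere (-p.1)) p.1) = 0
  have h := stereographic_neg_apply p.1
  -- The chart at a point of the sphere projects from its antipode, so the point itself goes to 0.
  exact (congrArg _ h).trans (map_zero _)

theorem meanDirection_extChartAt_symm (p : Param) :
    ∃ L : EuclideanSpace ℝ (Fin 2) →ₗᵢ[ℝ] E3, (∀ w, inner ℝ (L w) (-p.1 : E3) = 0) ∧
      ∀ y, meanDirection ((extChartAt J p).symm y) =
        (‖y.1‖ ^ 2 + 4)⁻¹ • (4 : ℝ) • L y.1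
          + (‖y.1‖ ^ 2 + 4)⁻¹ • (‖y.1‖ ^ 2 - 4) • (-p.1 : E3) := by
  have : Fact (finrank ℝ E3 = 2 + 1) := ⟨finrank_euclideanSpace_fin⟩
  set U := (OrthonormalBasis.fromOrthogonalSpanSingleton (𝕜 := ℝ) 2
    (ne_zero_of_mem_unit_sphere (-p.1))).repr with hU
  refine ⟨(Submodule.subtypeₗᵢ _).comp U.symm.toLinearIsometry, fun w => ?_, fun y => ?_⟩
  · exact Submodule.mem_orthogonal_singleton_iff_inner_left.1 (U.symm w).2
  · have h : meanDirection ((extChartAt J p).symm y) = _ := stereographic'_symm_apply (-p.1) y.1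
    have hn : ‖(U.symm y.1 : E3)‖ = ‖y.1‖ := U.symm.norm_map y.1
    rw [h]
    simp only [← hU, hn]
    rfl

end VMF

/-! ### Differentials read in charts -/

section ExtChartAt

variable {V : Type*} [NormedAddCommGroup V] [NormedSpace ℝ V]
    {H : Type*} [TopologicalSpace H] {I : ModelWithCorners ℝ V H} [I.Boundaryless]
    {M : Type*} [TopologicalSpace M] [ChartedSpace H M]
    {F : Type*} [NormedAddCommGroup F] [NormedSpace ℝ F] {f : M → F}

theorem MDifferentiableAt.mvfderiv_mfderiv_extChartAt_symm [IsManifold I ∞ M] {p : M} {y : V}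
    (hy : y ∈ (extChartAt I p).target)
    (hf : MDifferentiableAt I 𝓘(ℝ, F) f ((extChartAt I p).symm y)) (e : V) :
    mvfderiv I f ((extChartAt I p).symm y) (mfderiv 𝓘(ℝ, V) I (extChartAt I p).symm y e) =
      fderiv ℝ (fun x => f ((extChartAt I p).symm x)) y e := by
  have : IsManifold I 1 M := IsManifold.of_le (n := ∞) (by norm_num)
  have hs : MDifferentiableAt 𝓘(ℝ, V) I (extChartAt I p).symm y := by
    have := mdifferentiableWithinAt_extChartAt_symm hy
    rwa [I.range_eq_univ, mdifferentiableWithinAt_univ] at this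
  have h := mfderiv_comp y hf hs
  rw [mfderiv_eq_fderiv] at h
  exact (congrArg (fun A : V →L[ℝ] F => A e) h).symm

theorem MDifferentiableAt.mvfderiv_eq_fderiv {p : M} (hf : MDifferentiableAt I 𝓘(ℝ, F) f p)
    (u : TangentSpace I p) :
    mvfderiv I f p u = fderiv ℝ (fun x => f ((extChartAt I p).symm x)) (extChartAt I p p) u := by
  have h := hf.mfderiv
  rw [I.range_eq_univ, fderivWithin_univ] at h
  exact congrArg (fun A : V →L[ℝ] F => A u) h

/-- The tangent space at p is modelled on V through the preferred chart at p, whose differential at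
p is therefore the identity. -/
theorem RiemCurv.tangentCoord_eq_repr [IsManifold I ∞ M] {ι : Type*} (b : Basis ι ℝ V) (p : M)
    (u : V) : RiemCurv.tangentCoord I b p u = b.repr u := by
  have : IsManifold I 1 M := IsManifold.of_le (n := ∞) (by norm_num)
  exact congrArg (fun A : V →L[ℝ] V => ⇑(b.repr (A u))) (mfderiv_extChartAt_self (I := I) (x := p))

end ExtChartAt

/-! ### Conformality of stereographic projection -/

section Stereographic

variable {V W : Type*} [NormedAddCommGroup V] [InnerProductSpace ℝ V] [NormedAddCommGroup W]
    [InnerProductSpace ℝ W]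

/-- Inverse stereographic projection from `n`. -/
def stereographicSymm (L : V →ₗᵢ[ℝ] W) (n : W) (w : V) : W :=
  (‖w‖ ^ 2 + 4)⁻¹ • (4 : ℝ) • L w + (‖w‖ ^ 2 + 4)⁻¹ • (‖w‖ ^ 2 - 4) • n

theorem differentiable_stereographicSymm (L : V →ₗᵢ[ℝ] W) (n : W) :
    Differentiable ℝ (stereographicSymm L n) := by
  have h (w : V) : ‖w‖ ^ 2 + 4 ≠ 0 := by positivity
  have hL : Differentiable ℝ L := L.toContinuousLinearMap.differentiable
  have hN : Differentiable ℝ fun w : V => ‖w‖ ^ 2 := (differentiable_id (𝕜 := ℝ)).norm_sq ℝ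
  have hI : Differentiable ℝ fun w : V => (‖w‖ ^ 2 + 4)⁻¹ := (hN.add_const 4).inv h
  exact (hI.smul (hL.const_smul (4 : ℝ))).add (hI.smul ((hN.sub_const 4).smul_const n))

theorem fderiv_stereographicSymm (L : V →ₗᵢ[ℝ] W) (n : W) (w a : V) :
    fderiv ℝ (stereographicSymm L n) w a =
      (4 / (‖w‖ ^ 2 + 4)) • L a - (8 * inner ℝ w a / (‖w‖ ^ 2 + 4) ^ 2) • L w
        + (16 * inner ℝ w a / (‖w‖ ^ 2 + 4) ^ 2) • n := by
  have h : ‖w‖ ^ 2 + 4 ≠ 0 := by positivity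
  have hL : HasFDerivAt L L.toContinuousLinearMap w := L.toContinuousLinearMap.hasFDerivAt
  have hN := (hasStrictFDerivAt_norm_sq w).hasFDerivAt
  have hI := (hasDerivAt_inv h).comp_hasFDerivAt w (hN.add_const 4)
  have hD := (hI.smul (hL.const_smul (4 : ℝ))).add (hI.smul ((hN.sub_const 4).smul_const n))
  have hD' : HasFDerivAt (stereographicSymm L n) _ w := hD
  rw [hD'.fderiv]
  simp
  match_scalars <;> field_simp <;> ring

/-- Inverse stereographic projection is conformal. -/
theorem inner_fderiv_stereographicSymm (L : V →ₗᵢ[ℝ] W) {n : W} (hn : ‖n‖ = 1)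
    (hL : ∀ w, inner ℝ (L w) n = 0) (w a b : V) :
    inner ℝ (fderiv ℝ (stereographicSymm L n) w a) (fderiv ℝ (stereographicSymm L n) w b) =
      16 / (4 + ‖w‖ ^ 2) ^ 2 * inner ℝ a b := by
  have h : ‖w‖ ^ 2 + 4 ≠ 0 := by positivity
  have hL' (w : V) : inner ℝ n (L w) = 0 := (real_inner_comm _ _).trans (hL w)
  simp only [fderiv_stereographicSymm, inner_add_left, inner_add_right, inner_sub_left,
    inner_sub_right, real_inner_smul_left, real_inner_smul_right, L.inner_map_map, hL, hL',
    real_inner_self_eq_norm_sq, hn, real_inner_comm w a, add_comm (4 : ℝ)]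
  field_simp
  ring

end Stereographic

/-! ### The Rao–Fisher metric in coordinates and its sectional curvature -/

namespace VMF

local notation "E3" => EuclideanSpace ℝ (Fin 3)
local notation "E21" => EuclideanSpace ℝ (Fin 2) × ℝ

theorem concentration_extChartAt_symm (p : Param) {y : E21} (hy : y ∈ (extChartAt J p).target) :
    concentration ((extChartAt J p).symm y) = y.2 := by
  have h := extChartAt_snd p ((extChartAt J p).symm y)
  rw [(extChartAt J p).right_inv hy] at h
  exact h.symm

theorem fderiv_concentration_extChartAt_symm (p : Param) {y : E21}
    (hy : y ∈ (extChartAt J p).target) (a : E21) :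
    fderiv ℝ (fun x => concentration ((extChartAt J p).symm x)) y a = a.2 := by
  have h : (fun x => concentration ((extChartAt J p).symm x)) =ᶠ[nhds y] Prod.snd := by
    filter_upwards [(isOpen_extChartAt_target p).mem_nhds hy] with x hx
    exact concentration_extChartAt_symm p hx
  rw [h.fderiv_eq, fderiv_snd]
  rfl

theorem inner_fderiv_meanDirection_extChartAt_symm (p : Param) (y a b : E21) :
    inner ℝ (fderiv ℝ (fun x => meanDirection ((extChartAt J p).symm x)) y a)
        (fderiv ℝ (fun x => meanDirection ((extChartAt J p).symm x)) y b) =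
      16 / (4 + ‖y.1‖ ^ 2) ^ 2 * inner ℝ a.1 b.1 := by
  obtain ⟨L, hL, h⟩ := meanDirection_extChartAt_symm p
  have hd : HasFDerivAt (fun x => meanDirection ((extChartAt J p).symm x))
      (fderiv ℝ (stereographicSymm L (-p.1 : E3)) y.1 ∘L
        ContinuousLinearMap.fst ℝ (EuclideanSpace ℝ (Fin 2)) ℝ) y := by
    rw [funext h]
    exact (differentiable_stereographicSymm L _ y.1).hasFDerivAt.comp y
      (hasFDerivAt_fst (𝕜 := ℝ) (p := y))
  rw [hd.fderiv]
  exact inner_fderiv_stereographicSymm L (by rw [norm_neg, norm_coe_sphere]) hL y.1 a.1 b.1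

theorem mdifferentiable_meanDirection : MDifferentiable J 𝓘(ℝ, E3) meanDirection :=
  contMDiff_meanDirection.mdifferentiable (by simp)

theorem mdifferentiable_concentration : MDifferentiable J 𝓘(ℝ, ℝ) concentration :=
  contMDiff_concentration.mdifferentiable (by simp)

/-- The Rao–Fisher metric in a chart. -/
theorem fisherInner_mfderiv_extChartAt_symm (p : Param) {y : E21}
    (hy : y ∈ (extChartAt J p).target) (a b : E21) :
    fisherInner ((extChartAt J p).symm y) (mfderiv 𝓘(ℝ, E21) J (extChartAt J p).symm y a)
        (mfderiv 𝓘(ℝ, E21) J (extChartAt J p).symm y b) =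
      I₀ y.2 * (a.2 * b.2) + I₁ y.2 * (16 / (4 + ‖y.1‖ ^ 2) ^ 2 * inner ℝ a.1 b.1) := by
  set z := (extChartAt J p).symm y with hz
  have hc (e : E21) : dσ z (mfderiv 𝓘(ℝ, E21) J (extChartAt J p).symm y e) = e.2 :=
    ((mdifferentiable_concentration _).mvfderiv_mfderiv_extChartAt_symm hy e).trans
      (fderiv_concentration_extChartAt_symm p hy e)
  have hm (e : E21) := (mdifferentiable_meanDirection _).mvfderiv_mfderiv_extChartAt_symm hy e
  rw [← inner_fderiv_meanDirection_extChartAt_symm p, ← hm, ← hm, fisherInner_apply, hc, hc,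
    show (z.2 : ℝ) = y.2 from concentration_extChartAt_symm p hy]
  rfl

theorem dσ_eq (p : Param) (u : E21) : dσ p u = u.2 :=
  ((mdifferentiable_concentration p).mvfderiv_eq_fderiv u).trans
    (fderiv_concentration_extChartAt_symm p (mem_extChartAt_target p) u)

theorem dθsq_eq (p : Param) (u v : E21) : dθsq p u v = inner ℝ u.1 v.1 := by
  have hm (e : E21) := (mdifferentiable_meanDirection p).mvfderiv_eq_fderiv e
  have h := inner_fderiv_meanDirection_extChartAt_symm p (extChartAt J p p) u v
  rw [← hm, ← hm, extChartAt_self, norm_zero] at h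
  refine Eq.trans h ?_
  norm_num

theorem fisherInner_eq (p : Param) (u v : E21) :
    fisherInner p u v = I₀ p.2 * (u.2 * v.2) + I₁ p.2 * inner ℝ u.1 v.1 := by
  rw [← dθsq_eq p, ← dσ_eq p u, ← dσ_eq p v]
  exact fisherInner_apply p u v

/-- The Rao–Fisher metric of the von Mises–Fisher model. -/
def fisherMetric : Bundle.ContMDiffRiemannianMetric J ∞ E21 (fun z : Param => TangentSpace J z) where
  inner := fisherInner
  symm z u v := by
    rw [fisherInner_apply, fisherInner_apply, mul_comm (dσ z u)]
    exact congrArg _ (congrArg _ (real_inner_comm _ _))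
  pos z v hv := by
    have h0 := I₀_pos z.2.2
    have h1 := I₁_pos z.2.2
    have hv' : (v : E21) ≠ 0 := hv
    refine lt_of_lt_of_eq ?_ (fisherInner_eq z v v).symm
    rw [real_inner_self_eq_norm_sq]
    by_cases h : (v : E21).2 = 0
    · have : (v : E21).1 ≠ 0 := fun h' => hv' (Prod.ext h' h)
      have := norm_pos_iff.2 this
      rw [h]
      positivity
    · have := mul_self_pos.2 h
      positivity
  isVonNBounded z := by
    have h0 := I₀_pos z.2.2
    have h1 := I₁_pos z.2.2
    change Bornology.IsVonNBounded ℝ {v : E21 | fisherInner z v v < 1}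
    refine NormedSpace.isVonNBounded_of_isBounded ℝ (isBounded_iff_forall_norm_le.2
      ⟨1 + 1 / I₁ z.2 + 1 / I₀ z.2, fun v hv => ?_⟩)
    rw [Set.mem_ofPred_eq, fisherInner_eq, real_inner_self_eq_norm_sq] at hv
    -- From 2|t| ≤ 1 + t²; a bound without square roots is enough for boundedness.
    have key {c t : ℝ} (hc : 0 < c) (h : c * t ^ 2 < 1) : |t| ≤ 1 + 1 / c := by
      have : t ^ 2 ≤ 1 / c := by
        rw [le_div_iff₀ hc]; linarith
      nlinarith [sq_abs t, sq_nonneg (|t| - 1)]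
    have a1 := key h1 (t := ‖v.1‖) (by nlinarith [mul_nonneg h0.le (mul_self_nonneg v.2)])
    have a2 := key h0 (t := v.2) (by nlinarith [mul_nonneg h1.le (sq_nonneg ‖v.1‖)])
    rw [abs_norm] at a1
    have b1 : 0 < 1 / I₁ z.2 := by positivity
    have b0 : 0 < 1 / I₀ z.2 := by positivity
    refine max_le ?_ ?_
    · linarith
    · rw [Real.norm_eq_abs]; linarith
  contMDiff := contMDiff_fisherInner

theorem metricInChart_fisherMetric (p : Param) :
    RiemCurv.metricInChart stdBasis fisherMetric p =ᶠ[nhds (extChartAt J p p)]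
      RiemCurv.warpedMatrix I₁ I₀ := by
  filter_upwards [extChartAt_target_mem_nhds p] with y hy
  ext i j
  refine (fisherInner_mfderiv_extChartAt_symm p hy _ _).trans ?_
  rcases i with i | i <;> rcases j with j | j
  · by_cases h : i = j
    · subst h
      simp [RiemCurv.warpedMatrix, RiemCurv.stdBasis_inl]
    · simp [RiemCurv.warpedMatrix, RiemCurv.stdBasis_inl, EuclideanSpace.inner_single_left, h]
  all_goals simp [RiemCurv.warpedMatrix, RiemCurv.stdBasis_inl, RiemCurv.stdBasis_inr]

theorem stdBasis_repr_inl (u : E21) (i : Fin 2) : stdBasis.repr u (.inl i) = u.1 i := by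
  simp [stdBasis]

theorem stdBasis_repr_inr (u : E21) (i : Unit) : stdBasis.repr u (.inr i) = u.2 := by
  simp [stdBasis]

/-- The Gram determinant in the denominator is the sum of the weights in the numerator (Lagrange's
identity), so the quotient is a weighted mean of the two curvature functions. -/
theorem sectionalCurvature_fisherMetric (p : Param) (u v : E21) :
    RiemCurv.sectionalCurvature stdBasis fisherMetric p u v =
      (sphericalCurvature p.2 * (I₁ p.2 ^ 2 * (u.1 0 * v.1 1 - u.1 1 * v.1 0) ^ 2)
        + radialCurvature p.2 * (I₁ p.2 * I₀ p.2 *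
          ((u.1 0 * v.2 - u.2 * v.1 0) ^ 2 + (u.1 1 * v.2 - u.2 * v.1 1) ^ 2))) /
      (I₁ p.2 ^ 2 * (u.1 0 * v.1 1 - u.1 1 * v.1 0) ^ 2 + I₁ p.2 * I₀ p.2 *
          ((u.1 0 * v.2 - u.2 * v.1 0) ^ 2 + (u.1 1 * v.2 - u.2 * v.1 1) ^ 2)) := by
  have hG := metricInChart_fisherMetric p
  rw [extChartAt_self] at hG
  have hpos : ∀ᶠ t in nhds (p.2 : ℝ), 0 < t := eventually_gt_nhds p.2.2
  have hnum := RiemCurv.curvatureForm_of_eventuallyEq_warpedMatrix hG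
    (hpos.mono fun t ht => hasDerivAt_I₁ ht) (hasDerivAt_derivI₁ p.2.2)
    (hpos.mono fun t ht => hasDerivAt_I₀ ht) (differentiableAt_derivI₀ p.2.2)
    (I₁_pos p.2.2).ne' (I₀_pos p.2.2).ne' (stdBasis.repr u) (stdBasis.repr v)
  simp only [stdBasis_repr_inl, stdBasis_repr_inr] at hnum
  refine congrArg₂ (· / ·) ?_ ?_
  · rw [extChartAt_self]
    refine Eq.trans ?_ hnum
    exact congrArg₂ _ (RiemCurv.tangentCoord_eq_repr stdBasis p u)
      (RiemCurv.tangentCoord_eq_repr stdBasis p v)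
  · change fisherInner p u u * fisherInner p v v - fisherInner p u v ^ 2 = _
    simp only [fisherInner_eq, PiLp.inner_apply, Fin.sum_univ_two, RCLike.inner_apply,
      conj_trivial]
    ring

/-- If all minors vanish, then v_i u - u_i v = 0 for each coordinate i. Independence gives u_i = 0
for all i, so u = 0, a contradiction. -/
theorem minors_pos_of_linearIndependent {u v : E21} (huv : LinearIndependent ℝ ![u, v]) :
    0 < (u.1 0 * v.1 1 - u.1 1 * v.1 0) ^ 2 ∨
      0 < (u.1 0 * v.2 - u.2 * v.1 0) ^ 2 + (u.1 1 * v.2 - u.2 * v.1 1) ^ 2 := by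
  by_contra! h
  rw [LinearIndependent.pair_iff] at huv
  have h1 : u.1 0 * v.1 1 - u.1 1 * v.1 0 = 0 := by nlinarith
  have h2 : u.1 0 * v.2 - u.2 * v.1 0 = 0 := by nlinarith
  have h3 : u.1 1 * v.2 - u.2 * v.1 1 = 0 := by nlinarith
  have key (s t : ℝ) (e0 : s * u.1 0 + t * v.1 0 = 0) (e1 : s * u.1 1 + t * v.1 1 = 0)
      (e2 : s * u.2 + t * v.2 = 0) : t = 0 := by
    refine (huv s t (Prod.ext (PiLp.ext fun i => ?_) e2)).2
    fin_cases i
    exacts [e0, e1]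
  have u0 := key (v.1 0) (-u.1 0) (by ring) (by linarith) (by linarith)
  have u1 := key (v.1 1) (-u.1 1) (by linarith) (by ring) (by linarith)
  have u2 := key v.2 (-u.2) (by linarith) (by linarith) (by ring)
  rw [neg_eq_zero] at u0 u1 u2
  have := (huv 1 0 (by
    rw [one_smul, zero_smul, add_zero]
    refine Prod.ext (PiLp.ext fun i => ?_) u2
    fin_cases i
    exacts [u0, u1])).1
  exact one_ne_zero this

theorem sectionalCurvature_fisherMetric_neg (p : Param) {u v : E21}
    (huv : LinearIndependent ℝ ![u, v]) :
    RiemCurv.sectionalCurvature stdBasis fisherMetric p u v < 0 := by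
  rw [sectionalCurvature_fisherMetric]
  have h0 := I₀_pos p.2.2
  have h1 := I₁_pos p.2.2
  have hs := sphericalCurvature_neg p.2.2
  have hr := radialCurvature_neg p.2.2
  have hA := mul_nonneg (sq_nonneg (I₁ p.2)) (sq_nonneg (u.1 0 * v.1 1 - u.1 1 * v.1 0))
  have hB := mul_nonneg (mul_pos h1 h0).le (add_nonneg (sq_nonneg (u.1 0 * v.2 - u.2 * v.1 0))
    (sq_nonneg (u.1 1 * v.2 - u.2 * v.1 1)))
  rcases minors_pos_of_linearIndependent huv with h | h
  · have := mul_pos (pow_pos h1 2) h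
    exact div_neg_of_neg_of_pos (add_neg_of_neg_of_nonpos (mul_neg_of_neg_of_pos hs this)
      (mul_nonpos_of_nonpos_of_nonneg hr.le hB)) (add_pos_of_pos_of_nonneg this hB)
  · have := mul_pos (mul_pos h1 h0) h
    exact div_neg_of_neg_of_pos (add_neg_of_nonpos_of_neg
      (mul_nonpos_of_nonpos_of_nonneg hs.le hA) (mul_neg_of_neg_of_pos hr this))
      (add_pos_of_nonneg_of_pos hA this)

theorem sectionalCurvature_fisherMetric_of_horizontal (p : Param) {u v : E21}
    (huv : LinearIndependent ℝ ![u, v]) (hu : u.2 = 0) (hv : v.2 = 0) :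
    RiemCurv.sectionalCurvature stdBasis fisherMetric p u v = sphericalCurvature p.2 := by
  have h := minors_pos_of_linearIndependent huv
  have h1 := I₁_pos p.2.2
  rw [sectionalCurvature_fisherMetric]
  simp only [hu, hv, mul_zero, zero_mul, sub_zero, ne_eq, OfNat.ofNat_ne_zero, not_false_eq_true,
    zero_pow, add_zero, lt_self_iff_false, or_false] at h ⊢
  exact mul_div_cancel_right₀ _ (mul_pos (pow_pos h1 2) h).ne'

end VMF

end

theorem mainTheorem5 :
    -- the von Mises–Fisher densities are probability densities, with a well-defined Fisher form
    (∀ z : VMF.Param, (∀ x, 0 < VMF.density z x) ∧ Integrable (VMF.density z) VMF.area ∧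
      ∫ x, VMF.density z x ∂VMF.area = 1) ∧
    (∀ (x : VMF.S2) (z : VMF.Param),
      MDifferentiableAt VMF.J 𝓘(ℝ, ℝ) (fun w : VMF.Param => Real.log (VMF.density w x)) z) ∧
    (∀ (z : VMF.Param) (u v : TangentSpace VMF.J z),
      Integrable (fun x => score VMF.J VMF.density z u x * score VMF.J VMF.density z v x
        * VMF.density z x) VMF.area) ∧
    -- expression of the Rao–Fisher metric
    (∀ (z : VMF.Param) (u v : TangentSpace VMF.J z),
      fisherForm VMF.J VMF.area VMF.density z u v =
        (1 / (z.2 : ℝ) ^ 2 - 1 / Real.sinh (z.2 : ℝ) ^ 2) * (VMF.dσ z u * VMF.dσ z v)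
          + ((z.2 : ℝ) * (Real.cosh (z.2 : ℝ) / Real.sinh (z.2 : ℝ)) - 1) * VMF.dθsq z u v) ∧
    -- it is a Riemannian metric on `S² × (0, ∞)`
    ∃ g : Bundle.ContMDiffRiemannianMetric VMF.J ∞ (EuclideanSpace ℝ (Fin 2) × ℝ)
        (fun z : VMF.Param => TangentSpace VMF.J z),
      (∀ (z : VMF.Param) (u v : TangentSpace VMF.J z),
        g.inner z u v = fisherForm VMF.J VMF.area VMF.density z u v) ∧
      -- its sectional curvature on the planes tangent to the spheres `S² × {σ}`
      (∀ (z : VMF.Param) (u v : TangentSpace VMF.J z), LinearIndependent ℝ ![u, v] →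
        VMF.dσ z u = 0 → VMF.dσ z v = 0 →
        RiemCurv.sectionalCurvature VMF.stdBasis g z u v =
          1 / VMF.I₁ z.2 - (1 / 4) * (VMF.derivR VMF.I₁ z.2 / VMF.I₁ z.2) ^ 2) ∧
      -- its sectional curvature is strictly negative on all planes
      (∀ (z : VMF.Param) (u v : TangentSpace VMF.J z), LinearIndependent ℝ ![u, v] →
        RiemCurv.sectionalCurvature VMF.stdBasis g z u v < 0) := by
  open VMF in
  refine ⟨fun z => ⟨density_pos z, integrable_area (continuous_density z), integral_density z⟩,
    fun x z => (hasMFDerivAt_log_density z x).mdifferentiableAt, integrable_score_mul_score,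
    fisherForm_eq, fisherMetric,
    fun z u v => (fisherInner_apply z u v).trans (fisherForm_eq z u v).symm,
    fun z u v huv hu hv => ?_, fun z u v huv => sectionalCurvature_fisherMetric_neg z huv⟩
  -- In the preferred chart dσ is the last coordinate, so the radial weights vanish.
  exact (VMF.sectionalCurvature_fisherMetric_of_horizontal z huv ((VMF.dσ_eq z u).symm.trans hu)
    ((VMF.dσ_eq z v).symm.trans hv)).trans (VMF.sphericalCurvature_eq z.2.2)
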